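/- For an irrational number $\alpha$ let $\mu(\alpha)=\bigl(\liminf_{p\in\mathbb Z,\,q\in\mathbb N}|q(q\alpha-p)|\bigr)^{-1}\in(0,\infty]$, and let the Lagrange spectrum $\mathbb L\subset\mathbb R$ be the set of all finite values $\mu(\alpha)$, $\alpha$ irrational. An irrational number $\alpha$ is called attainable if $\bigl|\alpha-\frac pq\bigr|\le\frac1{\mu(\alpha)q^2}$ for infinitely many pairs of integers $(p,q)$ with $q>0$; a number $\lambda\in\mathbb L$ is called admissible if $\lambda=\mu(\alpha)$ for some attainable irrational number $\alpha$. An open interval $(a,b)$ with $a<b$ is a maximal gap of $\mathbb L$ if $a,b\in\mathbb L$ and $(a,b)\cap\mathbb L=\emptyset$. For a doubly infinite sequence $B=(b_i)_{i\in\mathbb Z}$ of positive integers put $\lambda_i(B)=[b_i;b_{i-1},b_{i-2},\ldots]+[0;b_{i+1},b_{i+2},\ldots]$ and $M(B)=\sup_{i\in\mathbb Z}\lambda_i(B)$. Call $B$ purely periodic if there is a positive integer $p$ with $b_{i+p}=b_i$ for all $i\in\mathbb Z$. Write $1^k$ for a block of $k$ ones, and a bar over a block for its infinite repetition. For an integer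 $n\ge 2$ let $$\alpha_n^*=2+[0;1^{2n-2},\overline{2,2,1,2}]+[0;1^{2n-1},2,1^{2n-2},\overline{2,2,1,2}],\qquad \beta_n=2+2\,[0;\overline{1^{2n},2}].$$ Theorem. For every integer $n\ge2$ the number $\alpha_n^*$ is irrational and not admissible. Moreover: 1. $\alpha_n^*\in\mathbb L$, and $(\alpha_n^*,\beta_n)$ is a maximal gap of $\mathbb L$. 2. A doubly infinite sequence $B$ of positive integers satisfies $\lambda_0(B)=M(B)=\alpha_n^*$ if and only if, up to the reflection $(b_i)_{i\in\mathbb Z}\mapsto(b_{-i})_{i\in\mathbb Z}$, it is the sequence $$(\overline{2,1,2,2},\,1^{2n-2},\,2^{*},\,1^{2n-1},\,2,\,1^{2n-2},\,\overline{2,2,1,2}),$$ where the starred entry is $b_0$, the first bar stands for infinite repetition to the left and the last bar for infinite repetition to the right. 3. No such sequence $B$ is purely periodic. -/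

import Mathlib

open Filter Topology
open scoped ENNReal Stream'

noncomputable section

/-! ### The Lagrange spectrum and admissible numbers -/

/-- The Lagrange constant `μ(α) = (liminf |q (q α - p)|)⁻¹`, the lower limit being taken over the
pairs `(p, q)` with `p` an integer and `q` a positive integer. It may be `∞`. -/
def lagrangeConstant (α : ℝ) : ℝ≥0∞ :=
  (liminf (fun r : ℤ × ℕ+ =>
    ENNReal.ofReal |((r.2 : ℕ) : ℝ) * (((r.2 : ℕ) : ℝ) * α - (r.1 : ℝ))|) cofinite)⁻¹

/-- The Lagrange spectrum: the (finite) values of `μ(α)` as `α` runs through the irrationals. -/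
def lagrangeSpectrum : Set ℝ :=
  {l | ∃ α : ℝ, Irrational α ∧ (lagrangeConstant α : EReal) = (l : EReal)}

/-- `α` is attainable: it is irrational and `|α - p / q| ≤ 1 / (μ(α) q ^ 2)` has infinitely many
solutions in integers `p` and `q > 0`. -/
def IsAttainable (α : ℝ) : Prop :=
  Irrational α ∧
    {r : ℤ × ℕ+ | ENNReal.ofReal |α - (r.1 : ℝ) / ((r.2 : ℕ) : ℝ)| ≤
      1 / (lagrangeConstant α * ((r.2 : ℕ) : ℝ≥0∞) ^ 2)}.Infinite

/-- A point of the Lagrange spectrum is admissible if it is the Lagrange constant of an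
attainable (irrational) number. -/
def IsAdmissible (l : ℝ) : Prop :=
  l ∈ lagrangeSpectrum ∧ ∃ α : ℝ, IsAttainable α ∧ (lagrangeConstant α : EReal) = (l : EReal)

/-- `(a, b)` is a maximal gap of the set `S`: an open interval that does not meet `S` and whose
two endpoints lie in `S`. -/
def IsMaximalGap (S : Set ℝ) (a b : ℝ) : Prop :=
  a < b ∧ a ∈ S ∧ b ∈ S ∧ Disjoint (Set.Ioo a b) S

/-! ### Infinite continued fractions -/

/-- The finite continued fraction `[0; a₁, …, aₖ]`, where `(a₁, a₂, …)` is the given stream. -/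
def cfTrunc : ℕ → Stream' ℕ+ → ℝ
  | 0, _ => 0
  | k + 1, a => 1 / (((a.head : ℕ) : ℝ) + cfTrunc k a.tail)

/-- The infinite continued fraction `[0; a₁, a₂, …]`. -/
def cfVal (a : Stream' ℕ+) : ℝ := limUnder atTop fun k => cfTrunc k a

theorem cfTrunc_nonneg (k : ℕ) (a : Stream' ℕ+) : 0 ≤ cfTrunc k a := by
  induction k generalizing a with
  | zero => simp [cfTrunc]
  | succ k ih =>
    have := ih a.tail
    simp only [cfTrunc]
    positivity

theorem one_le_head (a : Stream' ℕ+) : (1 : ℝ) ≤ ((a.head : ℕ) : ℝ) := by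
  exact_mod_cast a.head.pos

theorem cfTrunc_le_one (k : ℕ) (a : Stream' ℕ+) : cfTrunc k a ≤ 1 := by
  cases k with
  | zero => simp [cfTrunc]
  | succ k =>
    have h1 := cfTrunc_nonneg k a.tail
    have h2 := one_le_head a
    simp only [cfTrunc]
    rw [div_le_one (by linarith)]
    linarith

theorem abs_cfTrunc_sub_le (j k l : ℕ) (a : Stream' ℕ+) :
    |cfTrunc (k + 2 * j) a - cfTrunc (l + 2 * j) a| ≤ (1 / 4) ^ j := by
  induction j generalizing a with
  | zero =>
    have h1 := cfTrunc_nonneg k a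
    have h2 := cfTrunc_nonneg l a
    have h3 := cfTrunc_le_one k a
    have h4 := cfTrunc_le_one l a
    simp only [mul_zero, add_zero, pow_zero]
    rw [abs_le]
    constructor <;> linarith
  | succ j ih =>
    have e1 : k + 2 * (j + 1) = (k + 2 * j) + 1 + 1 := by ring
    have e2 : l + 2 * (j + 1) = (l + 2 * j) + 1 + 1 := by ring
    rw [e1, e2]
    simp only [cfTrunc]
    have hx := cfTrunc_nonneg (k + 2 * j) a.tail.tail
    have hy := cfTrunc_nonneg (l + 2 * j) a.tail.tail
    have hi := ih a.tail.tail
    have hb := one_le_head a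
    have hc := one_le_head a.tail
    generalize cfTrunc (k + 2 * j) a.tail.tail = x at *
    generalize cfTrunc (l + 2 * j) a.tail.tail = y at *
    generalize ((a.head : ℕ) : ℝ) = b at *
    generalize ((a.tail.head : ℕ) : ℝ) = c at *
    have hX : 0 < c + x := by linarith
    have hY : 0 < c + y := by linarith
    have kx : 2 ≤ b * (c + x) + 1 := by nlinarith
    have ky : 2 ≤ b * (c + y) + 1 := by nlinarith
    have e : 1 / (b + 1 / (c + x)) - 1 / (b + 1 / (c + y)) =
        (x - y) / ((b * (c + x) + 1) * (b * (c + y) + 1)) := by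
      have h1 : b + 1 / (c + x) = (b * (c + x) + 1) / (c + x) := by field_simp
      have h2 : b + 1 / (c + y) = (b * (c + y) + 1) / (c + y) := by field_simp
      rw [h1, h2]
      field_simp
      ring
    have hp : (4 : ℝ) ≤ (b * (c + x) + 1) * (b * (c + y) + 1) := by nlinarith
    rw [e, abs_div, abs_of_pos (by linarith : 0 < (b * (c + x) + 1) * (b * (c + y) + 1))]
    calc |x - y| / ((b * (c + x) + 1) * (b * (c + y) + 1)) ≤ |x - y| / 4 := by gcongr
      _ ≤ (1 / 4) ^ j / 4 := by gcongr
      _ = (1 / 4) ^ (j + 1) := by ring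

/-- The convergents of an infinite continued fraction do converge, so that `cfVal` is its value. -/
theorem tendsto_cfTrunc (a : Stream' ℕ+) :
    Tendsto (fun k => cfTrunc k a) atTop (𝓝 (cfVal a)) := by
  have hc : CauchySeq fun k => cfTrunc k a := by
    rw [Metric.cauchySeq_iff']
    intro ε hε
    obtain ⟨j, hj⟩ := exists_pow_lt_of_lt_one hε (by norm_num : (1 / 4 : ℝ) < 1)
    refine ⟨2 * j, fun n hn => ?_⟩
    obtain ⟨m, rfl⟩ := Nat.exists_eq_add_of_le hn
    have := abs_cfTrunc_sub_le j m 0 a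
    rw [Real.dist_eq]
    rw [add_comm (2 * j) m]
    rw [zero_add] at this
    exact lt_of_le_of_lt this hj
  exact tendsto_nhds_limUnder (cauchySeq_tendsto_of_complete hc)

/-! ### Doubly infinite sequences -/

/-- `λ_i(B) = [b_i; b_{i-1}, b_{i-2}, …] + [0; b_{i+1}, b_{i+2}, …]`. -/
def lam (B : ℤ → ℕ+) (i : ℤ) : ℝ :=
  (((B i : ℕ) : ℝ) + cfVal fun k : ℕ => B (i - 1 - k)) + cfVal fun k : ℕ => B (i + 1 + k)

/-- `M(B) = sup_i λ_i(B)`, possibly `∞`. -/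
def markoffSup (B : ℤ → ℕ+) : EReal := ⨆ i : ℤ, (lam B i : EReal)

/-- `B` realizes the real number `a`: `λ_0(B) = M(B) = a`. -/
def Realizes (B : ℤ → ℕ+) (a : ℝ) : Prop :=
  lam B 0 = a ∧ markoffSup B = (a : EReal)

/-- `B` consists of a finite nonempty block repeated infinitely often in both directions. -/
def IsPurelyPeriodic (B : ℤ → ℕ+) : Prop :=
  ∃ p : ℕ, 0 < p ∧ ∀ i : ℤ, B (i + p) = B i

/-- The doubly infinite sequence `(…, l₂, l₁, c, r₁, r₂, …)` with `c` at the index `0`. -/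
def twoSided (l : Stream' ℕ+) (c : ℕ+) (r : Stream' ℕ+) : ℤ → ℕ+
  | Int.ofNat 0 => c
  | Int.ofNat (k + 1) => r.get k
  | Int.negSucc k => l.get k

/-! ### Gbur's sequences -/

/-- The block `1, …, 1` of `k` ones. -/
def ones (k : ℕ) : List ℕ+ := List.replicate k 1

/-- The periodic sequence `2, 2, 1, 2, 2, 2, 1, 2, …`. -/
def per2212 : Stream' ℕ+ := Stream'.cycle [2, 2, 1, 2] (by simp)

/-- `1^{2n-2}, (2,2,1,2)^∞`. -/
def gburX (n : ℕ) : Stream' ℕ+ := ones (2 * n - 2) ++ₛ per2212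

/-- `1^{2n-1}, 2, 1^{2n-2}, (2,2,1,2)^∞`. -/
def gburY (n : ℕ) : Stream' ℕ+ := (ones (2 * n - 1) ++ [2] ++ ones (2 * n - 2)) ++ₛ per2212

/-- Gbur's left endpoint
`α_n^* = 2 + [0; 1^{2n-2}, (2,2,1,2)^∞] + [0; 1^{2n-1}, 2, 1^{2n-2}, (2,2,1,2)^∞]`. -/
def gburAlpha (n : ℕ) : ℝ := 2 + cfVal (gburX n) + cfVal (gburY n)

/-- Gbur's right endpoint `β_n = 2 + 2 [0; (1^{2n}, 2)^∞]`. -/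
def gburBeta (n : ℕ) : ℝ := 2 + 2 * cfVal (Stream'.cycle (ones (2 * n) ++ [2]) (by simp))

/-- The doubly infinite sequence
`(^∞(2,1,2,2), 1^{2n-2}, 2, 1^{2n-1}, 2, 1^{2n-2}, (2,2,1,2)^∞)`, with the first of the two
displayed isolated entries `2` at the index `0`. -/
def gburSeq (n : ℕ) : ℤ → ℕ+ := twoSided (gburX n) 2 (gburY n)

end

/-! By Legendre's theorem, only convergents matter for approximation constants above 2, and the
convergent before the digit `a k` has quality `1 / lamNat a k`. So a Lagrange constant above 2 is
the limsup of `lamNat a k` (`lagrangeConstant_eq_iff`). Shifts of a bounded digit sequence converge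
along nonprincipal ultrafilters to doubly infinite sequences, and `lamNat` converges to `lam` there.
Questions about the spectrum near the gap thus become questions about two-sided sequences `B` with
every `lam B i < β_n` (`BelowBeta`).

The core is `BelowBeta.lam_zero_le`: such a `B` satisfies `lam B 0 ≤ α_n^*`, with equality only for
Gbur's sequence and its reflection. All digits are 1 or 2, and around a 2 one compares the two
blocks of ones. The block that ends first has even length (`not_odd_run`), at most `2n-2`
(`not_both_long`). Then minimality of the periodic tail among words avoiding `2121` bounds that side
by X, and the other side is at most Y when the short block has length `2n-2`. Shorter blocks give
strictly less. The comparisons rest on an identity for `psi l r + psi l s - 2 psi l c`, where `psi l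
t = [0; 1^l, t]`, whose sign is governed by the arithmetic and harmonic means of `r` and `s`.
Injectivity of continued fractions settles the equality case.

The core gives the gap and the list of realizing sequences. The right endpoint comes from a periodic
expansion, the left one from a one-sided sequence gluing ever longer pieces of Gbur's sequence. For
non-admissibility, an attainable number with constant `α_n^*` would have infinitely many `k` with
`lamNat a k ≥ α_n^*`, around which the digits look like Gbur's sequence. But far to the left of a
late such `k` lies an earlier copy, containing two adjacent ones; so the backward expansion departs
from the periodic tail, and by minimality this makes `lamNat a k` strictly less than `α_n^*`.

Irrationality is separate: X and Y lie in `ℚ(√30)` with `√30`-coefficients of the same sign, which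
cannot cancel. -/

/-! ### Continued fractions with a real tail -/

/-- The continued fraction `[0; a₁, …, aₖ + x]`. -/
noncomputable def cfTail : ℕ → (ℕ → ℕ+) → ℝ → ℝ
  | 0, _, x => x
  | k + 1, a, x => 1 / (((a 0 : ℕ) : ℝ) + cfTail k (fun i => a (i + 1)) x)

theorem one_le_pnat (b : ℕ+) : (1 : ℝ) ≤ ((b : ℕ) : ℝ) := by
  exact_mod_cast b.pos

theorem cfVal_nonneg (a : ℕ → ℕ+) : 0 ≤ cfVal a :=
  ge_of_tendsto' (tendsto_cfTrunc a) fun k => cfTrunc_nonneg k a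

theorem cfVal_le_one (a : ℕ → ℕ+) : cfVal a ≤ 1 :=
  le_of_tendsto' (tendsto_cfTrunc a) fun k => cfTrunc_le_one k a

theorem cfVal_eq (a : ℕ → ℕ+) :
    cfVal a = 1 / (((a 0 : ℕ) : ℝ) + cfVal fun i => a (i + 1)) := by
  have h1 := (tendsto_cfTrunc a).comp (tendsto_add_atTop_nat 1)
  have h2 := tendsto_cfTrunc (fun i => a (i + 1))
  have h0 := cfVal_nonneg fun i => a (i + 1)
  have hb := one_le_pnat (a 0)
  have h3 := (tendsto_const_nhds (x := ((a 0 : ℕ) : ℝ))).add h2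
  have h4 := (tendsto_const_nhds (x := (1 : ℝ))).div h3 (by linarith)
  exact tendsto_nhds_unique h1 h4

theorem cfVal_pos (a : ℕ → ℕ+) : 0 < cfVal a := by
  rw [cfVal_eq]
  have h0 := cfVal_nonneg fun i => a (i + 1)
  have hb := one_le_pnat (a 0)
  positivity

theorem cfVal_lt_one (a : ℕ → ℕ+) : cfVal a < 1 := by
  rw [cfVal_eq]
  have h0 := cfVal_pos fun i => a (i + 1)
  have hb := one_le_pnat (a 0)
  rw [div_lt_one (by linarith)]
  linarith

theorem cfVal_eq_cfTail (k : ℕ) (a : ℕ → ℕ+) :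
    cfVal a = cfTail k a (cfVal fun i => a (i + k)) := by
  induction k generalizing a with
  | zero => rfl
  | succ k ih =>
    rw [cfVal_eq, ih]
    simp only [cfTail]
    have : ∀ i, i + k + 1 = i + (k + 1) := fun i => by ring
    simp only [this]

theorem cfTail_succ_last (k : ℕ) (a : ℕ → ℕ+) (x : ℝ) :
    cfTail (k + 1) a x = cfTail k a (1 / (((a k : ℕ) : ℝ) + x)) := by
  induction k generalizing a with
  | zero => rfl
  | succ k ih =>
    rw [cfTail, ih]
    rfl

theorem cfTail_nonneg (k : ℕ) (a : ℕ → ℕ+) {x : ℝ} (hx : 0 ≤ x) : 0 ≤ cfTail k a x := by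
  induction k generalizing a with
  | zero => exact hx
  | succ k ih =>
    have := ih fun i => a (i + 1)
    simp only [cfTail]
    positivity

theorem cfTrunc_eq_cfTail (k : ℕ) (a : ℕ → ℕ+) : cfTrunc k a = cfTail k a 0 := by
  induction k generalizing a with
  | zero => rfl
  | succ k ih =>
    simp only [cfTrunc, cfTail]
    rw [← ih]
    rfl

theorem cfTail_congr {k : ℕ} {a b : ℕ → ℕ+} (h : ∀ i < k, a i = b i) (x : ℝ) :
    cfTail k a x = cfTail k b x := by
  induction k generalizing a b with
  | zero => rfl
  | succ k ih =>
    simp only [cfTail]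
    rw [h 0 (by omega), ih (a := fun i => a (i + 1)) (b := fun i => b (i + 1))
      fun i hi => h (i + 1) (by omega)]

/-- Two steps of the expansion contract distances by at least 4: each of the two denominators `b *
(c + x) + 1` is at least 2. -/
theorem abs_cfTail_sub_le (j : ℕ) (a : ℕ → ℕ+) {x y : ℝ} (hx : 0 ≤ x) (hx1 : x ≤ 1)
    (hy : 0 ≤ y) (hy1 : y ≤ 1) :
    |cfTail (2 * j) a x - cfTail (2 * j) a y| ≤ (1 / 4) ^ j := by
  induction j generalizing a with
  | zero =>
    simp only [cfTail, pow_zero]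
    rw [abs_le]
    constructor <;> linarith
  | succ j ih =>
    rw [show 2 * (j + 1) = 2 * j + 1 + 1 by ring]
    simp only [cfTail]
    have hx := cfTail_nonneg (2 * j) (fun i => a (i + 1 + 1)) hx
    have hy := cfTail_nonneg (2 * j) (fun i => a (i + 1 + 1)) hy
    have hi := ih (fun i => a (i + 1 + 1))
    have hb := one_le_pnat (a 0)
    have hc := one_le_pnat (a (0 + 1))
    generalize cfTail (2 * j) (fun i => a (i + 1 + 1)) x = x at *
    generalize cfTail (2 * j) (fun i => a (i + 1 + 1)) y = y at *
    generalize ((a 0 : ℕ) : ℝ) = b at *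
    generalize ((a (0 + 1) : ℕ) : ℝ) = c at *
    have hX : 0 < c + x := by linarith
    have hY : 0 < c + y := by linarith
    have kx : 2 ≤ b * (c + x) + 1 := by nlinarith
    have ky : 2 ≤ b * (c + y) + 1 := by nlinarith
    have e : 1 / (b + 1 / (c + x)) - 1 / (b + 1 / (c + y)) =
        (x - y) / ((b * (c + x) + 1) * (b * (c + y) + 1)) := by
      have h1 : b + 1 / (c + x) = (b * (c + x) + 1) / (c + x) := by field_simp
      have h2 : b + 1 / (c + y) = (b * (c + y) + 1) / (c + y) := by field_simp
      rw [h1, h2]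
      field_simp
      ring
    have hp : (4 : ℝ) ≤ (b * (c + x) + 1) * (b * (c + y) + 1) := by nlinarith
    rw [e, abs_div, abs_of_pos (by linarith : 0 < (b * (c + x) + 1) * (b * (c + y) + 1))]
    calc |x - y| / ((b * (c + x) + 1) * (b * (c + y) + 1)) ≤ |x - y| / 4 := by gcongr
      _ ≤ (1 / 4) ^ j / 4 := by gcongr
      _ = (1 / 4) ^ (j + 1) := by ring

/-- `x ↦ [0; a₁, …, aₖ + x]` is strictly increasing or decreasing, according to the parity
of `k`. -/
theorem cfTail_lt (k : ℕ) (a : ℕ → ℕ+) {x y : ℝ} (hx : 0 ≤ x) (hxy : x < y) :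
    (Even k → cfTail k a x < cfTail k a y) ∧ (Odd k → cfTail k a y < cfTail k a x) := by
  induction k generalizing a with
  | zero => exact ⟨fun _ => hxy, fun h => by simp at h⟩
  | succ k ih =>
    have h1 := ih fun i => a (i + 1)
    have hb := one_le_pnat (a 0)
    have h2 := cfTail_nonneg k (fun i => a (i + 1)) hx
    have h3 := cfTail_nonneg k (fun i => a (i + 1)) (hx.trans hxy.le)
    simp only [cfTail]
    refine ⟨fun h => ?_, fun h => ?_⟩
    · have := h1.2 (by grind)
      exact one_div_lt_one_div_of_lt (by linarith) (by linarith)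
    · have := h1.1 (by grind)
      exact one_div_lt_one_div_of_lt (by linarith) (by linarith)

theorem abs_cfVal_sub_le (j : ℕ) {a b : ℕ → ℕ+} (h : ∀ i < 2 * j, a i = b i) :
    |cfVal a - cfVal b| ≤ (1 / 4) ^ j := by
  rw [cfVal_eq_cfTail (2 * j) a, cfVal_eq_cfTail (2 * j) b, cfTail_congr h]
  exact abs_cfTail_sub_le j b (cfVal_nonneg _) (cfVal_le_one _) (cfVal_nonneg _) (cfVal_le_one _)

theorem cfVal_head_tail {a b : ℕ → ℕ+} (h : cfVal a = cfVal b) :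
    a 0 = b 0 ∧ (cfVal fun i => a (i + 1)) = cfVal fun i => b (i + 1) := by
  rw [cfVal_eq a, cfVal_eq b] at h
  have a0 := cfVal_pos fun i => a (i + 1)
  have a1 := cfVal_lt_one fun i => a (i + 1)
  have b0 := cfVal_pos fun i => b (i + 1)
  have b1 := cfVal_lt_one fun i => b (i + 1)
  have ha := one_le_pnat (a 0)
  have hb := one_le_pnat (b 0)
  have h' : ((a 0 : ℕ) : ℝ) + (cfVal fun i => a (i + 1)) =
      ((b 0 : ℕ) : ℝ) + cfVal fun i => b (i + 1) := by
    rw [one_div, one_div] at h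
    exact inv_injective h
  have e : (a 0 : ℕ) = (b 0 : ℕ) := by
    apply le_antisymm
    · have : ((a 0 : ℕ) : ℝ) < ((b 0 : ℕ) : ℝ) + 1 := by linarith
      have : (a 0 : ℕ) < (b 0 : ℕ) + 1 := by exact_mod_cast this
      omega
    · have : ((b 0 : ℕ) : ℝ) < ((a 0 : ℕ) : ℝ) + 1 := by linarith
      have : (b 0 : ℕ) < (a 0 : ℕ) + 1 := by exact_mod_cast this
      omega
  refine ⟨PNat.eq e, ?_⟩
  rw [e] at h'
  linarith

theorem cfVal_injective {a b : ℕ → ℕ+} (h : cfVal a = cfVal b) : a = b := by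
  funext k
  induction k generalizing a b with
  | zero => exact (cfVal_head_tail h).1
  | succ k ih => exact ih (cfVal_head_tail h).2

theorem pnat_eq_one_or_two {b : ℕ+} (h : b ≤ 2) : b = 1 ∨ b = 2 := by
  have h1 : (b : ℕ) ≤ 2 := h
  have h2 := b.pos
  rcases (by omega : (b : ℕ) = 1 ∨ (b : ℕ) = 2) with h | h
  · exact Or.inl (PNat.eq h)
  · exact Or.inr (PNat.eq h)

theorem pnat_cast_le_two {b : ℕ+} (h : b ≤ 2) : ((b : ℕ) : ℝ) ≤ 2 := by
  exact_mod_cast (show (b : ℕ) ≤ 2 from h)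

/-- Bootstrapping: an upper bound `U` gives the lower bound `1 / (2 + U)`, and a lower bound `L`
gives the upper bound `1 / (1 + L)`. Starting from `U = 1` this produces 1/3, 3/4, 4/11, 11/15. -/
theorem cfVal_bounds {a : ℕ → ℕ+} (h : ∀ k, a k ≤ 2) : 4 / 11 ≤ cfVal a ∧ cfVal a ≤ 11 / 15 := by
  have low : ∀ b : ℕ → ℕ+, (∀ k, b k ≤ 2) → 1 / 3 ≤ cfVal b := fun b hb => by
    rw [cfVal_eq]
    have := cfVal_le_one fun i => b (i + 1)
    have := cfVal_nonneg fun i => b (i + 1)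
    have := pnat_cast_le_two (hb 0)
    have := one_le_pnat (b 0)
    exact one_div_le_one_div_of_le (by linarith) (by linarith)
  have up : ∀ b : ℕ → ℕ+, (∀ k, b k ≤ 2) → cfVal b ≤ 3 / 4 := fun b hb => by
    rw [cfVal_eq]
    have := low (fun i => b (i + 1)) fun k => hb _
    have := one_le_pnat (b 0)
    rw [div_le_iff₀ (by linarith)]
    linarith
  have low' : ∀ b : ℕ → ℕ+, (∀ k, b k ≤ 2) → 4 / 11 ≤ cfVal b := fun b hb => by
    rw [cfVal_eq]
    have := up (fun i => b (i + 1)) fun k => hb _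
    have := cfVal_nonneg fun i => b (i + 1)
    have := pnat_cast_le_two (hb 0)
    have := one_le_pnat (b 0)
    rw [le_div_iff₀ (by linarith)]
    linarith
  refine ⟨low' a h, ?_⟩
  rw [cfVal_eq]
  have := low' (fun i => a (i + 1)) fun k => h _
  have := one_le_pnat (a 0)
  rw [div_le_iff₀ (by linarith)]
  linarith

/-- Infinite descent on the denominator: if the value is `p / q`, then `p < q` and the tail is a
rational with denominator `p`. -/
theorem irrational_cfVal (a : ℕ → ℕ+) : Irrational (cfVal a) := by
  have key : ∀ q : ℕ, ∀ p : ℕ, ∀ a : ℕ → ℕ+, cfVal a * q = p → q = 0 := by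
    intro q
    induction q using Nat.strong_induction_on with
    | _ q ih =>
      intro p a h
      by_contra hq
      have hq' : (0 : ℝ) < q := by exact_mod_cast Nat.pos_of_ne_zero hq
      have h0 := cfVal_pos a
      have h1 := cfVal_lt_one a
      have hp : (p : ℝ) < q := by rw [← h]; nlinarith
      have hp' : p < q := by exact_mod_cast hp
      have hp0 : (0 : ℝ) < p := by rw [← h]; positivity
      have t0 := cfVal_pos fun i => a (i + 1)
      have e := cfVal_eq a
      have ha := one_le_pnat (a 0)
      have e2 : (cfVal fun i => a (i + 1)) * p = q - (a 0 : ℕ) * p := by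
        rw [← h, e]
        field_simp
        ring
      have hle : (a 0 : ℕ) * p ≤ q := by
        have : ((a 0 : ℕ) : ℝ) * p ≤ q := by
          have : 0 < (cfVal fun i => a (i + 1)) * p := by positivity
          linarith
        exact_mod_cast this
      have := ih p hp' (q - (a 0 : ℕ) * p) (fun i => a (i + 1)) (by
        rw [e2]; push_cast [Nat.cast_sub hle]; ring)
      rw [this] at hp0
      simp at hp0
  rintro ⟨r, hr⟩
  have h0 := cfVal_pos a
  have hr0 : 0 < r := by
    have : (0 : ℝ) < (r : ℝ) := by rw [hr]; exact h0
    exact_mod_cast this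
  have := key r.den r.num.toNat a (by
    rw [← hr]
    have h1 : ((r.num.toNat : ℤ) : ℝ) = (r.num : ℝ) := by
      rw [Int.toNat_of_nonneg (Rat.num_nonneg.mpr hr0.le)]
    have h2 : (r : ℝ) * r.den = r.num := by exact_mod_cast Rat.mul_den_eq_num r
    rw [h2, ← h1]
    exact Int.cast_natCast _)
  exact r.den_nz this

/-- Every irrational number has a continued fraction expansion. -/
theorem exists_eq_add_cfVal {α : ℝ} (hα : Irrational α) :
    ∃ (m : ℤ) (a : ℕ → ℕ+), α = m + cfVal a := by
  -- The orbit of the fractional part under the Gauss map; the digits are the integer parts of `1 /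
  -- x k`.
  let x : ℕ → ℝ := fun k => Nat.rec (Int.fract α) (fun _ y => Int.fract (1 / y)) k
  have xs : ∀ k, x (k + 1) = Int.fract (1 / x k) := fun k => rfl
  have hirr : ∀ k, Irrational (x k) := by
    intro k
    induction k with
    | zero => exact hα.sub_intCast _
    | succ k ih =>
      rw [xs, one_div]
      exact (irrational_inv_iff.mpr ih).sub_intCast _
  have h0 : ∀ k, 0 < x k := by
    intro k
    have : 0 ≤ x k := by
      cases k with
      | zero => exact Int.fract_nonneg _
      | succ k => exact Int.fract_nonneg _
    exact lt_of_le_of_ne this fun h => (hirr k).ne_zero h.symm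
  have h1 : ∀ k, x k < 1 := by
    intro k
    cases k with
    | zero => exact Int.fract_lt_one _
    | succ k => exact Int.fract_lt_one _
  have hf : ∀ k, 0 < ⌊1 / x k⌋ := by
    intro k
    rw [Int.floor_pos]
    rw [le_div_iff₀ (h0 k)]
    linarith [h1 k]
  let a : ℕ → ℕ+ := fun k => ⟨⌊1 / x k⌋.toNat, by have := hf k; omega⟩
  have ha : ∀ k, (((a k : ℕ+) : ℕ) : ℝ) = (⌊1 / x k⌋ : ℝ) := by
    intro k
    have : (((a k : ℕ) : ℤ)) = ⌊1 / x k⌋ := Int.toNat_of_nonneg (hf k).le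
    exact_mod_cast this
  have hx : ∀ k, x 0 = cfTail k a (x k) := by
    intro k
    induction k with
    | zero => rfl
    | succ k ih =>
      rw [cfTail_succ_last, ha, xs, Int.floor_add_fract, one_div_one_div]
      exact ih
  refine ⟨⌊α⌋, a, ?_⟩
  have hd : ∀ j : ℕ, |x 0 - cfVal a| ≤ (1 / 4) ^ j := by
    intro j
    rw [hx (2 * j), cfVal_eq_cfTail (2 * j) a]
    exact abs_cfTail_sub_le j a (h0 _).le (h1 _).le (cfVal_nonneg _) (cfVal_le_one _)
  have hz : |x 0 - cfVal a| ≤ 0 :=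
    ge_of_tendsto' (tendsto_pow_atTop_nhds_zero_of_lt_one (by norm_num) (by norm_num)) hd
  have : x 0 = cfVal a := by
    have := abs_nonpos_iff.mp hz
    linarith
  rw [← this]
  exact (Int.floor_add_fract α).symm

/-! ### Convergents and the Lagrange constant -/

/-- The finite continued fraction `[0; a_{k-1}, …, a_0]`. -/
noncomputable def cfRev (a : ℕ → ℕ+) : ℕ → ℝ
  | 0 => 0
  | k + 1 => 1 / (((a k : ℕ) : ℝ) + cfRev a k)

/-- `a_k + [0; a_{k-1}, …, a_0] + [0; a_{k+1}, a_{k+2}, …]`. -/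
noncomputable def lamNat (a : ℕ → ℕ+) (k : ℕ) : ℝ :=
  ((a k : ℕ) : ℝ) + cfRev a k + cfVal fun i => a (k + 1 + i)

/-- Numerator of the convergent `[0; a_0, …, a_{k-1}]`, together with the preceding one. -/
def convNum (a : ℕ → ℕ+) : ℕ → ℤ × ℤ
  | 0 => (0, 1)
  | k + 1 => (a k * (convNum a k).1 + (convNum a k).2, (convNum a k).1)

/-- Denominator of the convergent `[0; a_0, …, a_{k-1}]`, together with the preceding one. -/
def convDen (a : ℕ → ℕ+) : ℕ → ℕ × ℕ
  | 0 => (1, 0)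
  | k + 1 => (a k * (convDen a k).1 + (convDen a k).2, (convDen a k).1)

theorem convDen_pos (a : ℕ → ℕ+) (k : ℕ) : 0 < (convDen a k).1 := by
  induction k with
  | zero => exact one_pos
  | succ k ih =>
    have := (a k).pos
    simp only [convDen]
    positivity

theorem le_convDen (a : ℕ → ℕ+) (k : ℕ) : k ≤ (convDen a (k + 1)).1 := by
  induction k with
  | zero => exact Nat.zero_le _
  | succ k ih =>
    have h1 := (a (k + 1)).pos
    have h2 := convDen_pos a k
    have e : (convDen a (k + 1 + 1)).1 =
      a (k + 1) * (convDen a (k + 1)).1 + (convDen a k).1 := rfl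
    rw [e]
    have := Nat.le_mul_of_pos_left (convDen a (k + 1)).1 h1
    omega

theorem conv_det (a : ℕ → ℕ+) (k : ℕ) :
    (convNum a k).2 * (convDen a k).1 - (convNum a k).1 * (convDen a k).2 = (-1) ^ k := by
  induction k with
  | zero => rfl
  | succ k ih =>
    simp only [convNum, convDen]
    rw [pow_succ, ← ih]
    push_cast
    ring

theorem cfTail_eq_div (a : ℕ → ℕ+) (k : ℕ) {x : ℝ} (hx : 0 ≤ x) :
    cfTail k a x = ((convNum a k).1 + x * (convNum a k).2) /
      ((convDen a k).1 + x * (convDen a k).2) := by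
  induction k generalizing x with
  | zero => simp [cfTail, convNum, convDen]
  | succ k ih =>
    have hb := one_le_pnat (a k)
    have hq : (0 : ℝ) < (convDen a k).1 := by exact_mod_cast convDen_pos a k
    have hq' : (0 : ℝ) ≤ (convDen a k).2 := Nat.cast_nonneg _
    rw [cfTail_succ_last, ih (by positivity)]
    simp only [convNum, convDen]
    push_cast
    have : 0 < ((a k : ℕ) : ℝ) + x := by linarith
    rw [div_eq_div_iff (by positivity) (by positivity)]
    field_simp
    ring

theorem cfRev_nonneg (a : ℕ → ℕ+) (k : ℕ) : 0 ≤ cfRev a k := by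
  induction k with
  | zero => exact le_rfl
  | succ k ih => simp only [cfRev]; positivity

theorem cfRev_le_one (a : ℕ → ℕ+) (k : ℕ) : cfRev a k ≤ 1 := by
  cases k with
  | zero => exact zero_le_one
  | succ k =>
    have := cfRev_nonneg a k
    have := one_le_pnat (a k)
    simp only [cfRev]
    rw [div_le_one (by linarith)]
    linarith

theorem cfRev_eq_div (a : ℕ → ℕ+) (k : ℕ) :
    cfRev a k = (convDen a k).2 / (convDen a k).1 := by
  induction k with
  | zero => simp [cfRev, convDen]
  | succ k ih =>
    have hb := one_le_pnat (a k)
    have hq : (0 : ℝ) < (convDen a k).1 := by exact_mod_cast convDen_pos a k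
    have hq' : (0 : ℝ) ≤ (convDen a k).2 := Nat.cast_nonneg _
    simp only [cfRev, convDen]
    rw [ih]
    push_cast
    field_simp

theorem lamNat_pos (a : ℕ → ℕ+) (k : ℕ) : 0 < lamNat a k := by
  have := cfRev_nonneg a k
  have := cfVal_nonneg fun i => a (k + 1 + i)
  have := one_le_pnat (a k)
  unfold lamNat
  linarith

theorem le_lamNat (a : ℕ → ℕ+) (k : ℕ) : ((a k : ℕ) : ℝ) ≤ lamNat a k := by
  have := cfRev_nonneg a k
  have := cfVal_nonneg fun i => a (k + 1 + i)
  unfold lamNat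
  linarith

/-- The approximation quality of the convergents. -/
theorem abs_conv_sub (a : ℕ → ℕ+) (k : ℕ) :
    (convDen a k).1 * |(convDen a k).1 * cfVal a - (convNum a k).1| = 1 / lamNat a k := by
  have hq : (0 : ℝ) < (convDen a k).1 := by exact_mod_cast convDen_pos a k
  have hq' : (0 : ℝ) ≤ (convDen a k).2 := Nat.cast_nonneg _
  have hL := lamNat_pos a k
  have hx := cfVal_pos fun i => a (i + k)
  have hdet : ((convNum a k).2 : ℝ) * (convDen a k).1 - (convNum a k).1 * (convDen a k).2 =
    (-1) ^ k := by exact_mod_cast conv_det a k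
  have hlam : lamNat a k = 1 / (cfVal fun i => a (i + k)) + (convDen a k).2 / (convDen a k).1 := by
    rw [cfVal_eq fun i => a (i + k), ← cfRev_eq_div, one_div_one_div]
    unfold lamNat
    have : ∀ i, k + 1 + i = i + 1 + k := fun i => by ring
    simp only [this, zero_add]
    ring
  have hval := cfVal_eq_cfTail k a
  rw [cfTail_eq_div a k hx.le] at hval
  generalize (cfVal fun i => a (i + k)) = x at *
  generalize ((convDen a k).1 : ℝ) = q at *
  generalize ((convDen a k).2 : ℝ) = q' at *
  generalize ((convNum a k).1 : ℝ) = p at *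
  generalize ((convNum a k).2 : ℝ) = p' at *
  have hD : 0 < q + x * q' := by positivity
  have e : q * cfVal a - p = x / (q + x * q') * (-1) ^ k := by
    rw [hval, ← hdet]
    field_simp
    ring
  rw [e, abs_mul, abs_pow, abs_neg, abs_one, one_pow, mul_one, abs_of_pos (by positivity), hlam]
  field_simp

/-- Identifies the truncations with Mathlib's `Real.convergent`, so that Legendre's theorem applies.
-/
theorem convergent_eq (a : ℕ → ℕ+) (m : ℤ) (k : ℕ) :
    (((m + cfVal a).convergent k : ℚ) : ℝ) = m + cfTrunc k a := by
  have hfl : ∀ (m : ℤ) (a : ℕ → ℕ+), ⌊(m : ℝ) + cfVal a⌋ = m := fun m a => by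
    rw [Int.floor_eq_iff]
    constructor <;> linarith [cfVal_pos a, cfVal_lt_one a]
  induction k generalizing a m with
  | zero => simp only [Real.convergent_zero, hfl, cfTrunc]; simp
  | succ k ih =>
    rw [Real.convergent_succ, Int.fract, hfl]
    have e : ((m : ℝ) + cfVal a - m)⁻¹ = (((a 0 : ℕ) : ℤ) : ℝ) + cfVal fun i => a (i + 1) := by
      rw [add_sub_cancel_left, cfVal_eq, one_div, inv_inv]
      simp
    rw [e]
    push_cast
    have := ih (fun i => a (i + 1)) ((a 0 : ℕ) : ℤ)
    push_cast at this
    rw [this]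
    simp only [cfTrunc, one_div]
    rfl

/-- The pairs `(p, q)` for which `q |q α - p| ≤ 1 / c`. -/
def approxPairs (α c : ℝ) : Set (ℤ × ℕ+) :=
  {r | |((r.2 : ℕ) : ℝ) * (((r.2 : ℕ) : ℝ) * α - (r.1 : ℝ))| ≤ 1 / c}

/-- Legendre's theorem: since `1 / c < 1 / 2`, the fraction `p / q` equals a convergent, although
the pair need not be reduced. Reducing it only improves the quality, so the convergent itself has
quality at most `1 / c`. -/
theorem approxPairs_legendre (a : ℕ → ℕ+) (m : ℤ) {c : ℝ} (hc : 2 < c) {r : ℤ × ℕ+}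
    (hr : r ∈ approxPairs (m + cfVal a) c) :
    ∃ k, c ≤ lamNat a k ∧
      (r.1 : ℝ) * (convDen a k).1 = (m * (convDen a k).1 + (convNum a k).1) * (r.2 : ℕ) := by
  obtain ⟨p, q⟩ := r
  simp only [approxPairs, Set.mem_ofPred_eq] at hr ⊢
  set α : ℝ := m + cfVal a with hα
  have hq : (0 : ℝ) < ((q : ℕ) : ℝ) := by exact_mod_cast q.pos
  have hdist : |α - p / (q : ℕ)| ≤ 1 / c / (q : ℕ) ^ 2 := by
    rw [le_div_iff₀ (by positivity)]
    rw [abs_mul, abs_of_pos hq] at hr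
    have e : |α - p / (q : ℕ)| * (q : ℕ) = |((q : ℕ) : ℝ) * α - p| := by
      nth_rewrite 2 [← abs_of_pos hq]
      rw [← abs_mul]
      congr 1
      field_simp
    rw [sq, ← mul_assoc, e, mul_comm]
    exact hr
  let x : ℚ := (p : ℚ) / ((q : ℕ) : ℚ)
  have hx : (x : ℝ) = p / (q : ℕ) := by simp [x]
  have hden : (x.den : ℕ) ≤ (q : ℕ) := by
    have h1 : x = Rat.divInt p (q : ℕ) := by
      rw [Rat.divInt_eq_div]; simp [x]
    have h2 : ((x.den : ℕ) : ℤ) ∣ ((q : ℕ) : ℤ) := by rw [h1]; exact Rat.den_dvd _ _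
    exact Nat.le_of_dvd q.pos (by exact_mod_cast h2)
  have hden' : ((x.den : ℕ) : ℝ) ≤ ((q : ℕ) : ℝ) := by exact_mod_cast hden
  have hden0 : (0 : ℝ) < x.den := by exact_mod_cast x.den_pos
  have hlt : |α - x| < 1 / (2 * (x.den : ℝ) ^ 2) := by
    rw [hx]
    refine lt_of_le_of_lt hdist ?_
    rw [div_div]
    apply one_div_lt_one_div_of_lt (by positivity)
    have : (x.den : ℝ) ^ 2 ≤ ((q : ℕ) : ℝ) ^ 2 := by gcongr
    nlinarith [sq_pos_of_pos hden0]
  obtain ⟨k, hk⟩ := Real.exists_rat_eq_convergent hlt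
  have hval : (p : ℝ) / (q : ℕ) = m + (convNum a k).1 / (convDen a k).1 := by
    rw [← hx, hk, convergent_eq, cfTrunc_eq_cfTail, cfTail_eq_div a k le_rfl]
    simp
  have hD : (0 : ℝ) < (convDen a k).1 := by exact_mod_cast convDen_pos a k
  have heq : (p : ℝ) * (convDen a k).1 = (m * (convDen a k).1 + (convNum a k).1) * (q : ℕ) := by
    field_simp at hval
    linarith
  refine ⟨k, ?_, heq⟩
  -- The determinant identity gives the Bézout coefficients; coprimality makes the convergent's
  -- denominator divide `q`.
  have hcop : IsCoprime ((convDen a k).1 : ℤ) (m * (convDen a k).1 + (convNum a k).1) := by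
    have hd := conv_det a k
    rcases Nat.even_or_odd k with h | h
    · rw [h.neg_one_pow] at hd
      refine ⟨(convNum a k).2 + m * (convDen a k).2, -(convDen a k).2, ?_⟩
      linear_combination hd
    · rw [h.neg_one_pow] at hd
      refine ⟨-(convNum a k).2 - m * (convDen a k).2, (convDen a k).2, ?_⟩
      linear_combination -hd
  have hdvd : ((convDen a k).1 : ℤ) ∣ ((q : ℕ) : ℤ) := by
    have hZ : p * ((convDen a k).1 : ℤ) =
      (m * (convDen a k).1 + (convNum a k).1) * ((q : ℕ) : ℤ) := by exact_mod_cast heq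
    exact hcop.dvd_of_dvd_mul_left (Dvd.intro_left p hZ)
  have hle : (convDen a k).1 ≤ (q : ℕ) := Nat.le_of_dvd q.pos (by exact_mod_cast hdvd)
  have hle' : ((convDen a k).1 : ℝ) ≤ (q : ℕ) := by exact_mod_cast hle
  have h3 := abs_conv_sub a k
  have e : |((convDen a k).1 : ℝ) * cfVal a - (convNum a k).1| =
      (convDen a k).1 * |α - p / (q : ℕ)| := by
    nth_rewrite 2 [← abs_of_pos hD]
    rw [← abs_mul, hval, hα]
    congr 1
    field_simp
    ring
  rw [e] at h3
  have h4 : 1 / lamNat a k ≤ 1 / c := by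
    rw [← h3, ← mul_assoc, ← sq]
    calc ((convDen a k).1 : ℝ) ^ 2 * |α - p / (q : ℕ)|
        ≤ ((q : ℕ) : ℝ) ^ 2 * (1 / c / (q : ℕ) ^ 2) := by gcongr
      _ = 1 / c := by field_simp
  exact (one_div_le_one_div (lamNat_pos a k) (by linarith)).mp h4

theorem infinite_approxPairs_iff (a : ℕ → ℕ+) (m : ℤ) {c : ℝ} (hc : 2 < c) :
    (approxPairs (m + cfVal a) c).Infinite ↔ {k | c ≤ lamNat a k}.Infinite := by
  constructor
  · intro hinf hfin
    apply hinf
    -- Each convergent accounts for finitely many pairs only: multiplying numerator and denominator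
    -- by `t` multiplies the quality by `t ^ 2`.
    have hsub : approxPairs (m + cfVal a) c ⊆ ⋃ k ∈ {k | c ≤ lamNat a k},
        {r : ℤ × ℕ+ | r ∈ approxPairs (m + cfVal a) c ∧
          (r.1 : ℝ) * (convDen a k).1 = (m * (convDen a k).1 + (convNum a k).1) * (r.2 : ℕ)} := by
      intro r hr
      obtain ⟨k, hk, h⟩ := approxPairs_legendre a m hc hr
      exact Set.mem_biUnion hk ⟨hr, h⟩
    refine (hfin.biUnion fun k _ => ?_).subset hsub
    have hD : (0 : ℝ) < (convDen a k).1 := by exact_mod_cast convDen_pos a k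
    have hL := lamNat_pos a k
    have hinj : Set.InjOn (fun r : ℤ × ℕ+ => r.2)
        {r : ℤ × ℕ+ | r ∈ approxPairs (m + cfVal a) c ∧
          (r.1 : ℝ) * (convDen a k).1 = (m * (convDen a k).1 + (convNum a k).1) * (r.2 : ℕ)} := by
      rintro ⟨p, q⟩ ⟨-, h1⟩ ⟨p', q'⟩ ⟨-, h2⟩ h3
      simp only at h1 h2 h3
      subst h3
      rw [← h2] at h1
      have : (p : ℝ) = p' := mul_right_cancel₀ hD.ne' h1
      have : p = p' := by exact_mod_cast this
      rw [this]
    refine Set.Finite.of_finite_image ?_ hinj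
    obtain ⟨N, hN⟩ := exists_nat_gt ((convDen a k).1 * lamNat a k)
    refine (Set.finite_Iic (⟨N + 1, Nat.succ_pos N⟩ : ℕ+)).subset ?_
    rintro q ⟨⟨p, q'⟩, ⟨h1, h2⟩, rfl⟩
    simp only [approxPairs, Set.mem_ofPred_eq] at h1 h2 ⊢
    have hq : (1 : ℝ) ≤ ((q' : ℕ) : ℝ) := one_le_pnat q'
    have e : ((q' : ℕ) : ℝ) * (m + cfVal a) - p =
        (q' : ℕ) / (convDen a k).1 * ((convDen a k).1 * cfVal a - (convNum a k).1) := by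
      field_simp
      linear_combination -h2
    have h3 := abs_conv_sub a k
    have h4 : |((convDen a k).1 : ℝ) * cfVal a - (convNum a k).1| =
        1 / lamNat a k / (convDen a k).1 := by
      rw [← h3]; field_simp
    rw [e, abs_mul, abs_mul, abs_of_pos (by linarith : (0 : ℝ) < (q' : ℕ)),
      abs_of_pos (by positivity), h4] at h1
    have h5 : 1 / c ≤ 1 := by rw [div_le_one (by linarith)]; linarith
    have h6 : ((q' : ℕ) : ℝ) * ((q' : ℕ) / (convDen a k).1 * (1 / lamNat a k / (convDen a k).1)) =
        (((q' : ℕ) : ℝ) / (convDen a k).1) ^ 2 / lamNat a k := by field_simp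
    rw [h6] at h1
    have h7 := h1.trans h5
    rw [div_le_one hL, div_pow, div_le_iff₀ (by positivity)] at h7
    have hD1 : (1 : ℝ) ≤ (convDen a k).1 := by exact_mod_cast convDen_pos a k
    have h8 : ((q' : ℕ) : ℝ) < N + 1 := by
      by_contra hcon
      push Not at hcon
      have hN' : (convDen a k).1 * lamNat a k < (q' : ℕ) := by linarith
      have hlq : ((convDen a k).1 : ℝ) ≤ (q' : ℕ) := by
        by_contra hlt
        push Not at hlt
        have : lamNat a k < 1 := by
          by_contra h9
          push Not at h9
          nlinarith
        have h10 := le_lamNat a k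
        have h11 := one_le_pnat (a k)
        linarith
      nlinarith
    have h9 : (q' : ℕ) < N + 1 := by exact_mod_cast h8
    exact h9.le
  · intro hinf
    let f : ℕ → ℤ × ℕ+ := fun k =>
      (m * (convDen a k).1 + (convNum a k).1, ⟨(convDen a k).1, convDen_pos a k⟩)
    have hf : ∀ k ∈ {k | c ≤ lamNat a k}, f k ∈ approxPairs (m + cfVal a) c := by
      intro k hk
      have hk' : c ≤ lamNat a k := hk
      have hD : (0 : ℝ) < (convDen a k).1 := by exact_mod_cast convDen_pos a k
      simp only [approxPairs, Set.mem_ofPred_eq, f, PNat.mk_coe]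
      push_cast
      rw [show ((convDen a k).1 : ℝ) * (m + cfVal a) - (m * (convDen a k).1 + (convNum a k).1) =
        (convDen a k).1 * cfVal a - (convNum a k).1 by ring, abs_mul, abs_of_pos hD, abs_conv_sub]
      exact one_div_le_one_div_of_le (by linarith) hk'
    intro hfin
    have hB := (hfin.image fun r : ℤ × ℕ+ => (r.2 : ℕ)).bddAbove
    obtain ⟨N, hN⟩ := hB
    apply hinf
    refine (Set.finite_Iic (N + 1)).subset ?_
    intro k hk
    have h1 := hN ⟨f k, hf k hk, rfl⟩
    simp only [f, PNat.mk_coe] at h1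
    cases k with
    | zero => simp
    | succ k =>
      have := le_convDen a k
      simp only [Set.mem_Iic]
      omega

/-- The right side says that the limsup of `lamNat a` is `l`. Only thresholds `c > 2` occur, since
Legendre's theorem needs them; they suffice because `l > 2`. -/
theorem lagrangeConstant_eq_iff (a : ℕ → ℕ+) (m : ℤ) {l : ℝ} (hl : 2 < l) :
    (lagrangeConstant (m + cfVal a) : EReal) = (l : EReal) ↔
      (∀ c, 2 < c → c < l → {k | c ≤ lamNat a k}.Infinite) ∧
        ∀ c, l < c → {k | c ≤ lamNat a k}.Finite := by
  set α : ℝ := m + cfVal a with hα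
  have h1 : (lagrangeConstant α : EReal) = (l : EReal) ↔
      liminf (fun r : ℤ × ℕ+ =>
        ENNReal.ofReal |((r.2 : ℕ) : ℝ) * (((r.2 : ℕ) : ℝ) * α - (r.1 : ℝ))|) cofinite =
      ENNReal.ofReal (1 / l) := by
    have e : (l : EReal) = ((ENNReal.ofReal l : ℝ≥0∞) : EReal) := by
      rw [EReal.coe_ennreal_ofReal, max_eq_left (by linarith)]
    rw [e, EReal.coe_ennreal_eq_coe_ennreal_iff, lagrangeConstant, one_div,
      ENNReal.ofReal_inv_of_pos (by linarith), inv_eq_iff_eq_inv]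
  rw [h1]
  have hmem : ∀ c, 0 < c → ∀ r : ℤ × ℕ+, r ∈ approxPairs α c ↔
      ENNReal.ofReal |((r.2 : ℕ) : ℝ) * (((r.2 : ℕ) : ℝ) * α - (r.1 : ℝ))| ≤
        ENNReal.ofReal (1 / c) := by
    intro c hc r
    rw [ENNReal.ofReal_le_ofReal_iff (by positivity)]
    rfl
  set f := fun r : ℤ × ℕ+ =>
        ENNReal.ofReal |((r.2 : ℕ) : ℝ) * (((r.2 : ℕ) : ℝ) * α - (r.1 : ℝ))| with hf
  constructor
  · intro h
    constructor
    · intro c hc hcl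
      rw [← infinite_approxPairs_iff a m hc, ← frequently_cofinite_mem_iff_infinite]
      have : liminf f cofinite < ENNReal.ofReal (1 / c) := by
        rw [h, ENNReal.ofReal_lt_ofReal_iff (by positivity)]
        exact one_div_lt_one_div_of_lt (by linarith) hcl
      refine (frequently_lt_of_liminf_lt (by isBoundedDefault) this).mono fun r hr => ?_
      exact (hmem c (by linarith) r).mpr hr.le
    · intro c hc
      rw [← Set.not_infinite, ← infinite_approxPairs_iff a m (by linarith), Set.not_infinite]
      have : ENNReal.ofReal (1 / c) < liminf f cofinite := by
        rw [h, ENNReal.ofReal_lt_ofReal_iff (by positivity)]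
        exact one_div_lt_one_div_of_lt (by linarith) hc
      have h2 := eventually_lt_of_lt_liminf this (by isBoundedDefault)
      rw [eventually_cofinite] at h2
      refine h2.subset fun r hr => ?_
      exact not_lt.mpr ((hmem c (by linarith) r).mp hr)
  · rintro ⟨hA, hB⟩
    apply le_antisymm
    · have : ∀ c, 2 < c → c < l → liminf f cofinite ≤ ENNReal.ofReal (1 / c) := by
        intro c hc hcl
        have h2 := (infinite_approxPairs_iff a m hc).mpr (hA c hc hcl)
        rw [← frequently_cofinite_mem_iff_infinite] at h2
        refine liminf_le_of_frequently_le' (h2.mono fun r hr => ?_)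
        exact (hmem c (by linarith) r).mp hr
      have hcont : Tendsto (fun c : ℝ => ENNReal.ofReal (1 / c)) (𝓝[<] l)
          (𝓝 (ENNReal.ofReal (1 / l))) := by
        refine (ENNReal.continuous_ofReal.tendsto _).comp ?_
        refine Tendsto.mono_left ?_ nhdsWithin_le_nhds
        exact (tendsto_const_nhds (x := (1 : ℝ))).div tendsto_id (by linarith)
      refine ge_of_tendsto hcont ?_
      filter_upwards [Ioo_mem_nhdsLT hl] with c hc
      exact this c hc.1 hc.2
    · have : ∀ c, l < c → ENNReal.ofReal (1 / c) ≤ liminf f cofinite := by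
        intro c hc
        have h2 := hB c hc
        rw [← Set.not_infinite, ← infinite_approxPairs_iff a m (by linarith),
          Set.not_infinite] at h2
        refine le_liminf_of_le (by isBoundedDefault) ?_
        rw [eventually_cofinite]
        refine h2.subset fun r hr => ?_
        exact (hmem c (by linarith) r).mpr (not_le.mp hr).le
      have hcont : Tendsto (fun c : ℝ => ENNReal.ofReal (1 / c)) (𝓝[>] l)
          (𝓝 (ENNReal.ofReal (1 / l))) := by
        refine (ENNReal.continuous_ofReal.tendsto _).comp ?_
        refine Tendsto.mono_left ?_ nhdsWithin_le_nhds
        exact (tendsto_const_nhds (x := (1 : ℝ))).div tendsto_id (by linarith)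
      refine le_of_tendsto hcont ?_
      filter_upwards [self_mem_nhdsWithin] with c hc
      exact this c hc

/-- An attainable number has infinitely many `λ_k` at least its Lagrange constant. -/
theorem infinite_of_isAttainable (a : ℕ → ℕ+) (m : ℤ) {l : ℝ} (hl : 2 < l)
    (h : IsAttainable (m + cfVal a))
    (hL : (lagrangeConstant (m + cfVal a) : EReal) = (l : EReal)) :
    {k | l ≤ lamNat a k}.Infinite := by
  rw [← infinite_approxPairs_iff a m hl]
  refine h.2.mono fun r hr => ?_
  have e : lagrangeConstant (m + cfVal a) = ENNReal.ofReal l := by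
    rw [← EReal.coe_ennreal_eq_coe_ennreal_iff, hL, EReal.coe_ennreal_ofReal,
      max_eq_left (by linarith)]
  have hq : (0 : ℝ) < ((r.2 : ℕ) : ℝ) := by exact_mod_cast r.2.pos
  simp only [Set.mem_ofPred_eq] at hr
  rw [e, ← ENNReal.ofReal_natCast, ← ENNReal.ofReal_pow hq.le,
    ← ENNReal.ofReal_mul (by linarith), one_div, ← ENNReal.ofReal_inv_of_pos (by positivity),
    ENNReal.ofReal_le_ofReal_iff (by positivity)] at hr
  simp only [approxPairs, Set.mem_ofPred_eq]
  rw [show ((r.2 : ℕ) : ℝ) * (((r.2 : ℕ) : ℝ) * (m + cfVal a) - (r.1 : ℝ)) =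
    ((r.2 : ℕ) : ℝ) ^ 2 * ((m + cfVal a) - (r.1 : ℝ) / ((r.2 : ℕ) : ℝ)) by field_simp, abs_mul,
    abs_of_pos (by positivity)]
  calc ((r.2 : ℕ) : ℝ) ^ 2 * |(m + cfVal a) - (r.1 : ℝ) / ((r.2 : ℕ) : ℝ)|
      ≤ ((r.2 : ℕ) : ℝ) ^ 2 * (l * ((r.2 : ℕ) : ℝ) ^ 2)⁻¹ := by gcongr
    _ = 1 / l := by field_simp

/-! ### Limits of shifted sequences -/

theorem tendsto_of_abs_sub_le_pow {F : Filter ℕ} {f : ℕ → ℝ} {l : ℝ}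
    (h : ∀ j : ℕ, ∀ᶠ k in F, |f k - l| ≤ (1 / 4) ^ j) : Tendsto f F (𝓝 l) := by
  rw [Metric.tendsto_nhds]
  intro ε hε
  obtain ⟨j, hj⟩ := exists_pow_lt_of_lt_one hε (by norm_num : (1 / 4 : ℝ) < 1)
  filter_upwards [h j] with k hk
  rw [Real.dist_eq]
  exact hk.trans_lt hj

theorem cfRev_eq_cfTail (a : ℕ → ℕ+) (m k : ℕ) (h : m ≤ k) :
    cfRev a k = cfTail m (fun i => a (k - 1 - i)) (cfRev a (k - m)) := by
  induction m generalizing k with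
  | zero => rfl
  | succ m ih =>
    obtain ⟨k, rfl⟩ : ∃ k', k = k' + 1 := ⟨k - 1, by omega⟩
    simp only [cfRev, cfTail]
    rw [ih k (by omega)]
    have e1 : ∀ i, k + 1 - 1 - (i + 1) = k - 1 - i := fun i => by omega
    simp only [e1]
    simp

theorem tendsto_lamNat {a : ℕ → ℕ+} {F : Filter ℕ} (hF : F ≤ atTop) {B : ℤ → ℕ+}
    (h : ∀ j : ℤ, ∀ᶠ k : ℕ in F, a ((k : ℤ) + j).toNat = B j) :
    Tendsto (lamNat a) F (𝓝 (lam B 0)) := by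
  have hall : ∀ N : ℕ, ∀ᶠ k : ℕ in F, N < k ∧
      ∀ j ∈ Finset.Icc (-(N : ℤ)) N, a ((k : ℤ) + j).toNat = B j := fun N =>
    ((eventually_gt_atTop N).filter_mono hF).and ((Finset.eventually_all _).mpr fun j _ => h j)
  refine Tendsto.add (Tendsto.add ?_ ?_) ?_
  · refine Tendsto.congr' ?_ tendsto_const_nhds
    filter_upwards [h 0] with k hk
    rw [← hk]
    simp
  · refine tendsto_of_abs_sub_le_pow fun j => ?_
    filter_upwards [hall (2 * j)] with k hk
    rw [cfRev_eq_cfTail a (2 * j) k hk.1.le, cfVal_eq_cfTail (2 * j)]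
    have e : ∀ i < 2 * j, a (k - 1 - i) = B (0 - 1 - i) := fun i hi => by
      rw [← hk.2 (0 - 1 - i) (by simp; omega)]
      congr 1
      omega
    rw [cfTail_congr e]
    exact abs_cfTail_sub_le j _ (cfRev_nonneg _ _) (cfRev_le_one _ _) (cfVal_nonneg _)
      (cfVal_le_one _)
  · refine tendsto_of_abs_sub_le_pow fun j => ?_
    filter_upwards [hall (2 * j)] with k hk
    refine abs_cfVal_sub_le j fun i hi => ?_
    rw [← hk.2 (0 + 1 + i) (by simp; omega)]
    congr 1
    omega

theorem lam_shift (B : ℤ → ℕ+) (i j : ℤ) : lam (fun k => B (k + j)) i = lam B (i + j) := by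
  unfold lam
  have e1 : ∀ k : ℕ, i - 1 - k + j = i + j - 1 - k := fun k => by ring
  have e2 : ∀ k : ℕ, i + 1 + k + j = i + j + 1 + k := fun k => by ring
  simp only [e1, e2]

theorem lam_neg (B : ℤ → ℕ+) (i : ℤ) : lam (fun k => B (-k)) i = lam B (-i) := by
  unfold lam
  have e1 : ∀ k : ℕ, -(i - 1 - k) = -i + 1 + (k : ℤ) := fun k => by ring
  have e2 : ∀ k : ℕ, -(i + 1 + k) = -i - 1 - (k : ℤ) := fun k => by ring
  simp only [e1, e2]
  ring

theorem tendsto_lamNat_shift {a : ℕ → ℕ+} {F : Filter ℕ} (hF : F ≤ atTop) {B : ℤ → ℕ+}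
    (h : ∀ j : ℤ, ∀ᶠ k : ℕ in F, a ((k : ℤ) + j).toNat = B j) (i : ℤ) :
    Tendsto (fun k : ℕ => lamNat a ((k : ℤ) + i).toNat) F (𝓝 (lam B i)) := by
  have hs : Tendsto (fun k : ℕ => ((k : ℤ) + i).toNat) F atTop := by
    refine Tendsto.mono_left ?_ hF
    rw [tendsto_atTop]
    intro b
    filter_upwards [eventually_ge_atTop (b + (-i).toNat)] with k hk
    omega
  have h2 := tendsto_lamNat (a := a) (F := F.map fun k : ℕ => ((k : ℤ) + i).toNat) hs
    (B := fun k => B (k + i)) (by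
      intro j
      rw [eventually_map]
      filter_upwards [h (j + i), hF (eventually_ge_atTop (-i).toNat)] with k hk hk2
      rw [← hk]
      congr 1
      omega)
  rw [lam_shift, zero_add] at h2
  exact h2

/-- Compactness: at each offset the digit takes finitely many values, and an ultrafilter selects
exactly one of them. -/
theorem exists_limit_sequence {a : ℕ → ℕ+} (U : Ultrafilter ℕ) (hU : (U : Filter ℕ) ≤ atTop)
    {M : ℕ+} (ha : ∀ᶠ k in atTop, a k ≤ M) :
    ∃ B : ℤ → ℕ+, ∀ j : ℤ, ∀ᶠ k : ℕ in U, a ((k : ℤ) + j).toNat = B j := by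
  have : ∀ j : ℤ, ∃ v : ℕ+, ∀ᶠ k : ℕ in U, a ((k : ℤ) + j).toNat = v := by
    intro j
    have h1 : ∀ᶠ k : ℕ in U, a ((k : ℤ) + j).toNat ≤ M := by
      refine hU ?_
      have ht : Tendsto (fun k : ℕ => ((k : ℤ) + j).toNat) atTop atTop := by
        rw [tendsto_atTop]
        intro b
        filter_upwards [eventually_ge_atTop (b + (-j).toNat)] with k hk
        omega
      exact ht.eventually ha
    have h2 : (⋃ v ∈ Set.Iic M, {k : ℕ | a ((k : ℤ) + j).toNat = v}) ∈ U := by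
      filter_upwards [h1] with k hk
      exact Set.mem_biUnion hk rfl
    obtain ⟨v, -, hv⟩ := (Ultrafilter.finite_biUnion_mem_iff (Set.finite_Iic M)).mp h2
    exact ⟨v, hv⟩
  choose B hB using this
  exact ⟨B, hB⟩

/-- An infinite set of indices is charged by a nonprincipal ultrafilter. -/
theorem exists_ultrafilter_of_infinite {K : Set ℕ} (hK : K.Infinite) :
    ∃ U : Ultrafilter ℕ, (U : Filter ℕ) ≤ atTop ∧ K ∈ U := by
  have : NeBot (atTop ⊓ 𝓟 K) := by
    rw [← frequently_mem_iff_neBot, Nat.frequently_atTop_iff_infinite]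
    exact hK
  refine ⟨Ultrafilter.of (atTop ⊓ 𝓟 K), (Ultrafilter.of_le _).trans inf_le_left, ?_⟩
  exact (Ultrafilter.of_le _).trans inf_le_right (mem_principal_self K)

/-- If the `λ_k` are eventually below `c`, along every ultrafilter there is a limit sequence. -/
theorem exists_limit_of_eventually_lt {a : ℕ → ℕ+} {c : ℝ} (h : ∀ᶠ k in atTop, lamNat a k < c)
    (U : Ultrafilter ℕ) (hU : (U : Filter ℕ) ≤ atTop) :
    ∃ B : ℤ → ℕ+, ∀ j : ℤ, ∀ᶠ k : ℕ in U, a ((k : ℤ) + j).toNat = B j := by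
  obtain ⟨N, hN⟩ := exists_nat_gt c
  refine exists_limit_sequence U hU (M := ⟨N + 1, Nat.succ_pos N⟩) ?_
  filter_upwards [h] with k hk
  have h1 := le_lamNat a k
  have h2 : ((a k : ℕ) : ℝ) < N := by linarith
  have h3 : (a k : ℕ) < N := by exact_mod_cast h2
  exact (by omega : (a k : ℕ) ≤ N + 1)

theorem lam_le_of_limit {a : ℕ → ℕ+} {c : ℝ} (h : ∀ᶠ k in atTop, lamNat a k < c)
    {U : Ultrafilter ℕ} (hU : (U : Filter ℕ) ≤ atTop) {B : ℤ → ℕ+}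
    (hB : ∀ j : ℤ, ∀ᶠ k : ℕ in U, a ((k : ℤ) + j).toNat = B j) (i : ℤ) : lam B i ≤ c := by
  refine le_of_tendsto (tendsto_lamNat_shift hU hB i) ?_
  have ht : Tendsto (fun k : ℕ => ((k : ℤ) + i).toNat) atTop atTop := by
    rw [tendsto_atTop]
    intro b
    filter_upwards [eventually_ge_atTop (b + (-i).toNat)] with k hk
    omega
  exact ((ht.eventually h).filter_mono hU).mono fun k hk => hk.le

/-! ### Blocks of ones -/

/-- The continued fraction `[0; 1^l, t]`. -/
noncomputable def psi : ℕ → ℝ → ℝ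
  | 0, t => 1 / t
  | l + 1, t => 1 / (1 + psi l t)

/-- The denominator of `[0; 1^l, t]`. -/
noncomputable def psiDen (l : ℕ) (t : ℝ) : ℝ := Nat.fib (l + 1) * t + Nat.fib l

theorem psi_pos (l : ℕ) {t : ℝ} (ht : 0 < t) : 0 < psi l t := by
  induction l with
  | zero => simpa [psi] using ht
  | succ l ih => simp only [psi]; positivity

theorem psiDen_pos (l : ℕ) {t : ℝ} (ht : 0 < t) : 0 < psiDen l t := by
  have : (0 : ℝ) < Nat.fib (l + 1) := by exact_mod_cast Nat.fib_pos.mpr l.succ_pos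
  unfold psiDen
  positivity

theorem psiDen_succ (l : ℕ) {t : ℝ} (ht : 0 < t) :
    psiDen (l + 1) t = psiDen l t * (1 + psi l t) := by
  induction l with
  | zero => simp [psiDen, psi]; field_simp
  | succ l ih =>
    have h1 : psi (l + 1) t = 1 / (1 + psi l t) := rfl
    have h2 := psi_pos l ht
    have h3 : psiDen (l + 1) t * psi (l + 1) t = psiDen l t := by
      rw [ih, h1]; field_simp
    rw [mul_add, mul_one, h3]
    simp only [psiDen]
    rw [Nat.fib_add_two (n := l + 1), Nat.fib_add_two (n := l)]
    push_cast
    ring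

theorem psi_sub (l : ℕ) {s t : ℝ} (hs : 0 < s) (ht : 0 < t) :
    psi l s - psi l t = (-1) ^ l * ((t - s) / (psiDen l s * psiDen l t)) := by
  induction l with
  | zero => simp [psi, psiDen]; field_simp
  | succ l ih =>
    have h1 := psi_pos l hs
    have h2 := psi_pos l ht
    have h3 := psiDen_pos l hs
    have h4 := psiDen_pos l ht
    rw [psiDen_succ l hs, psiDen_succ l ht]
    simp only [psi]
    have e : 1 / (1 + psi l s) - 1 / (1 + psi l t) =
        -(psi l s - psi l t) / ((1 + psi l s) * (1 + psi l t)) := by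
      field_simp; ring
    rw [e, ih]
    field_simp
    ring

/-- Of the two brackets in the numerator, one compares `c` with the harmonic mean of `r` and `s`,
the other with their arithmetic mean. When both have the same sign, the comparison holds for every
`l` up to the parity sign. -/
theorem psi_add_sub (l : ℕ) {r s c : ℝ} (hr : 0 < r) (hs : 0 < s) (hc : 0 < c) :
    psi l r + psi l s - 2 * psi l c = (-1) ^ l *
      ((Nat.fib (l + 1) * (c * (r + s) - 2 * r * s) + Nat.fib l * (2 * c - r - s)) /
        (psiDen l r * psiDen l s * psiDen l c)) := by
  have h1 := psi_sub l hr hc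
  have h2 := psi_sub l hs hc
  have d1 := psiDen_pos l hr
  have d2 := psiDen_pos l hs
  have d3 := psiDen_pos l hc
  have e : psi l r + psi l s - 2 * psi l c =
    (psi l r - psi l c) + (psi l s - psi l c) := by ring
  rw [e, h1, h2, ← mul_add]
  congr 1
  field_simp
  unfold psiDen
  ring

/-- Comparison of `[0; 1^l, r] + [0; 1^l, s]` with `2 [0; 1^l, c]` when `c` is less than the
harmonic mean of `r` and `s`. -/
theorem psi_add_of_lt_harmonic (l : ℕ) {r s c : ℝ} (hr : 0 < r) (hs : 0 < s) (hc : 0 < c)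
    (h : c * (r + s) < 2 * r * s) : (-1) ^ l * (psi l r + psi l s - 2 * psi l c) < 0 := by
  rw [psi_add_sub l hr hs hc, ← mul_assoc, ← mul_pow]
  have hf : (0 : ℝ) < Nat.fib (l + 1) := by exact_mod_cast Nat.fib_pos.mpr l.succ_pos
  have hf' : (0 : ℝ) ≤ Nat.fib l := Nat.cast_nonneg _
  -- Below the harmonic mean, hence below the arithmetic mean.
  have h2 : 2 * c - r - s ≤ 0 := by
    by_contra hcon
    push Not at hcon
    nlinarith [sq_nonneg (r - s)]
  have d1 := psiDen_pos l hr
  have d2 := psiDen_pos l hs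
  have d3 := psiDen_pos l hc
  norm_num
  exact div_neg_of_neg_of_pos (by nlinarith) (by positivity)

/-- Here `c` is at least the arithmetic mean, hence at least the harmonic one, and both brackets are
nonnegative. -/
theorem psi_add_of_mean_le (l : ℕ) {r s c : ℝ} (hr : 0 < r) (hs : 0 < s)
    (h : r + s ≤ 2 * c) : 0 ≤ (-1) ^ l * (psi l r + psi l s - 2 * psi l c) := by
  have hc : 0 < c := by linarith
  rw [psi_add_sub l hr hs hc, ← mul_assoc, ← mul_pow]
  have hf : (0 : ℝ) ≤ Nat.fib (l + 1) := Nat.cast_nonneg _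
  have hf' : (0 : ℝ) ≤ Nat.fib l := Nat.cast_nonneg _
  have h2 : 0 ≤ c * (r + s) - 2 * r * s := by nlinarith [sq_nonneg (r - s)]
  have d1 := psiDen_pos l hr
  have d2 := psiDen_pos l hs
  have d3 := psiDen_pos l hc
  norm_num
  have : 0 ≤ 2 * c - r - s := by linarith
  positivity

theorem psi_lt_of_even {l : ℕ} (hl : Even l) {s t : ℝ} (hs : 0 < s) (h : s < t) :
    psi l t < psi l s := by
  have := psi_sub l hs (hs.trans h)
  have d1 := psiDen_pos l hs
  have d2 := psiDen_pos l (hs.trans h)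
  rw [hl.neg_one_pow, one_mul] at this
  have : 0 < (t - s) / (psiDen l s * psiDen l t) := div_pos (by linarith) (by positivity)
  linarith

theorem psi_lt_of_odd {l : ℕ} (hl : Odd l) {s t : ℝ} (hs : 0 < s) (h : s < t) :
    psi l s < psi l t := by
  have := psi_sub l hs (hs.trans h)
  have d1 := psiDen_pos l hs
  have d2 := psiDen_pos l (hs.trans h)
  rw [hl.neg_one_pow] at this
  have : 0 < (t - s) / (psiDen l s * psiDen l t) := div_pos (by linarith) (by positivity)
  linarith

theorem psi_le_of_even {l : ℕ} (hl : Even l) {s t : ℝ} (hs : 0 < s) (h : s ≤ t) :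
    psi l t ≤ psi l s := by
  rcases h.eq_or_lt with rfl | h
  · exact le_rfl
  · exact (psi_lt_of_even hl hs h).le

theorem psi_le_of_odd {l : ℕ} (hl : Odd l) {s t : ℝ} (hs : 0 < s) (h : s ≤ t) :
    psi l s ≤ psi l t := by
  rcases h.eq_or_lt with rfl | h
  · exact le_rfl
  · exact (psi_lt_of_odd hl hs h).le

theorem psi_succ_eq (l : ℕ) (t : ℝ) : psi (l + 1) t = psi l (1 + 1 / t) := by
  induction l with
  | zero => simp [psi]
  | succ l ih => rw [psi, ih]; rfl

/-- The golden ratio is the fixed point of prefixing a one, so `φ - 1` is a threshold valid for all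
block lengths: values with an even block followed by a 2 lie below it, with an odd block above it.
-/
theorem psi_goldenRatio (l : ℕ) : psi l Real.goldenRatio = Real.goldenRatio - 1 := by
  have h0 := Real.goldenRatio_pos
  have h1 := Real.goldenRatio_sq
  have e : 1 / Real.goldenRatio = Real.goldenRatio - 1 := by
    rw [div_eq_iff h0.ne']; nlinarith
  induction l with
  | zero => exact e
  | succ l ih => rw [psi, ih, add_sub_cancel, e]

theorem goldenRatio_bounds :
    (1.6180 : ℝ) < Real.goldenRatio ∧ Real.goldenRatio < (1.6181 : ℝ) := by
  have h0 := Real.goldenRatio_pos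
  have h1 := Real.goldenRatio_sq
  constructor <;> nlinarith

theorem cfVal_eq_psi {w : ℕ → ℕ+} (l : ℕ) (h : ∀ i < l, w i = 1) :
    cfVal w = psi l (((w l : ℕ) : ℝ) + cfVal fun i => w (l + 1 + i)) := by
  induction l generalizing w with
  | zero =>
    rw [cfVal_eq]
    simp only [psi, add_comm]
  | succ l ih =>
    rw [cfVal_eq, h 0 (by omega), ih (w := fun i => w (i + 1)) fun i hi => h (i + 1) (by omega)]
    have e : ∀ i, l + 1 + i + 1 = l + 1 + 1 + i := fun i => by ring
    simp only [psi, e, PNat.one_coe, Nat.cast_one]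

/-! ### The sequences `X`, `Y` and the periodic tail -/

/-- The periodic sequence `2, 1, 2, 2, 2, 1, 2, 2, …`. -/
def perTail (k : ℕ) : ℕ+ := if k % 4 = 1 then 1 else 2

theorem per2212_get (k : ℕ) : per2212 k = if k % 4 = 2 then 1 else 2 := by
  have h : per2212 = [2, 2, 1, 2] ++ₛ per2212 := Stream'.cycle_eq _ _
  induction k using Nat.strong_induction_on with
  | _ k ih =>
    match k, ih with
    | 0, _ => rw [h]; rfl
    | 1, _ => rw [h]; rfl
    | 2, _ => rw [h]; rfl
    | 3, _ => rw [h]; rfl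
    | m + 4, ih =>
      rw [h]
      have e : ([2, 2, 1, 2] ++ₛ per2212) (m + 4) = per2212 m := rfl
      rw [e, ih m (by omega)]
      simp

theorem ones_append_get (l : ℕ) (s : Stream' ℕ+) (k : ℕ) :
    (ones l ++ₛ s) k = if k < l then 1 else s (k - l) := by
  induction l generalizing k with
  | zero => rfl
  | succ l ih =>
    have e : ones (l + 1) ++ₛ s = Stream'.cons 1 (ones l ++ₛ s) := rfl
    rw [e]
    cases k with
    | zero => rfl
    | succ k =>
      have e2 : (Stream'.cons 1 (ones l ++ₛ s)) (k + 1) = (ones l ++ₛ s) k := rfl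
      rw [e2, ih]
      simp

theorem gburX_get (n k : ℕ) :
    gburX n k = if k < 2 * n - 2 then 1 else if (k - (2 * n - 2)) % 4 = 2 then 1 else 2 := by
  rw [gburX, ones_append_get, per2212_get]

theorem gburY_get {n : ℕ} (hn : 1 ≤ n) (k : ℕ) :
    gburY n k = if k < 2 * n - 1 then 1 else if k = 2 * n - 1 then 2 else
      gburX n (k - 2 * n) := by
  have e : gburY n = ones (2 * n - 1) ++ₛ ([2] ++ₛ gburX n) := by
    rw [gburY, gburX, Stream'.append_append_stream, Stream'.append_append_stream]
  rw [e, ones_append_get]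
  by_cases h : k < 2 * n - 1
  · simp [h]
  · rw [if_neg h, if_neg h]
    obtain ⟨m, hm⟩ : ∃ m, k - (2 * n - 1) = m := ⟨_, rfl⟩
    rw [hm]
    cases m with
    | zero => rw [if_pos (by omega)]; rfl
    | succ m =>
      have e2 : ([2] ++ₛ gburX n) (m + 1) = gburX n m := rfl
      rw [if_neg (by omega), e2]
      congr 1
      omega

theorem gburX_le_two (n k : ℕ) : gburX n k ≤ 2 := by
  rw [gburX_get]
  split_ifs <;> decide

theorem perTail_le_two (k : ℕ) : perTail k ≤ 2 := by
  unfold perTail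
  split_ifs <;> decide

theorem pnat_two_coe : (((2 : ℕ+) : ℕ) : ℝ) = 2 := by norm_num

theorem cfVal_gburX (n : ℕ) : cfVal (gburX n) = psi (2 * n - 2) (2 + cfVal perTail) := by
  rw [cfVal_eq_psi (w := gburX n) (2 * n - 2) fun i hi => by rw [gburX_get, if_pos hi]]
  have e : (fun i => gburX n (2 * n - 2 + 1 + i)) = perTail := by
    funext i
    rw [gburX_get, if_neg (by omega), perTail]
    congr 1
    simp only [eq_iff_iff]
    omega
  rw [e, gburX_get, if_neg (by omega), if_neg (by simp), pnat_two_coe]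

theorem cfVal_gburY {n : ℕ} (hn : 1 ≤ n) :
    cfVal (gburY n) = psi (2 * n - 1) (2 + cfVal (gburX n)) := by
  rw [cfVal_eq_psi (w := gburY n) (2 * n - 1) fun i hi => by rw [gburY_get hn, if_pos hi]]
  have e : (fun i => gburY n (2 * n - 1 + 1 + i)) = gburX n := by
    funext i
    rw [gburY_get hn, if_neg (by omega), if_neg (by omega)]
    congr 1
    omega
  rw [e, gburY_get hn, if_neg (by omega), if_pos rfl, pnat_two_coe]

/-- The periodic sequence `1^{2n}, 2, 1^{2n}, 2, …`. -/
def betaTail (n : ℕ) : Stream' ℕ+ := Stream'.cycle (ones (2 * n) ++ [2]) (by simp)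

theorem betaTail_eq (n : ℕ) : betaTail n = ones (2 * n) ++ₛ Stream'.cons 2 (betaTail n) := by
  have h : betaTail n = (ones (2 * n) ++ [2]) ++ₛ betaTail n := Stream'.cycle_eq _ _
  rw [Stream'.append_append_stream] at h
  exact h

theorem betaTail_get (n k : ℕ) : betaTail n k = if k % (2 * n + 1) = 2 * n then 2 else 1 := by
  induction k using Nat.strong_induction_on with
  | _ k ih =>
    rw [betaTail_eq, ones_append_get]
    by_cases h : k < 2 * n
    · rw [if_pos h, Nat.mod_eq_of_lt (by omega), if_neg (by omega)]
    · rw [if_neg h]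
      obtain ⟨m, rfl⟩ := Nat.exists_eq_add_of_le (not_lt.mp h)
      rw [Nat.add_sub_cancel_left]
      cases m with
      | zero =>
        rw [if_pos (by rw [add_zero, Nat.mod_eq_of_lt (by omega)])]
        rfl
      | succ m =>
        have e : Stream'.cons 2 (betaTail n) (m + 1) = betaTail n m := rfl
        rw [e, ih m (by omega), show 2 * n + (m + 1) = m + (2 * n + 1) by ring,
          Nat.add_mod_right]

theorem betaTail_le_two (n k : ℕ) : betaTail n k ≤ 2 := by
  rw [betaTail_get]
  split_ifs <;> decide

theorem cfVal_betaTail (n : ℕ) :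
    cfVal (betaTail n) = psi (2 * n) (2 + cfVal (betaTail n)) := by
  have hget : ∀ k, betaTail n k =
      if k < 2 * n then 1 else Stream'.cons 2 (betaTail n) (k - 2 * n) := by
    intro k
    nth_rewrite 1 [betaTail_eq]
    exact ones_append_get _ _ _
  refine (cfVal_eq_psi (w := betaTail n) (2 * n) fun i hi => by rw [hget, if_pos hi]).trans ?_
  have e : (fun i => betaTail n (2 * n + 1 + i)) = betaTail n := by
    funext i
    rw [hget, if_neg (by omega), show 2 * n + 1 + i - 2 * n = i + 1 by omega]
    rfl
  rw [e, hget, if_neg (by omega), Nat.sub_self]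
  have : Stream'.cons 2 (betaTail n) 0 = 2 := rfl
  rw [this, pnat_two_coe]

theorem gburBeta_eq (n : ℕ) : gburBeta n = 2 + 2 * cfVal (betaTail n) := rfl

/-! ### Numerical comparison of X, Y and the two endpoints. -/

theorem cfVal_betaTail_lt (n : ℕ) : cfVal (betaTail n) < Real.goldenRatio - 1 := by
  rw [cfVal_betaTail, ← psi_goldenRatio (2 * n)]
  have := goldenRatio_bounds
  have := cfVal_pos (betaTail n)
  exact psi_lt_of_even (even_two_mul n) Real.goldenRatio_pos (by linarith)

theorem even_two_mul_sub (n : ℕ) : Even (2 * n - 2) := ⟨n - 1, by omega⟩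

theorem odd_two_mul_sub {n : ℕ} (hn : 1 ≤ n) : Odd (2 * n - 1) := ⟨n - 1, by omega⟩

theorem cfVal_gburX_lt (n : ℕ) : cfVal (gburX n) < Real.goldenRatio - 1 := by
  rw [cfVal_gburX, ← psi_goldenRatio (2 * n - 2)]
  have := goldenRatio_bounds
  have := cfVal_pos perTail
  exact psi_lt_of_even (even_two_mul_sub n) Real.goldenRatio_pos (by linarith)

theorem lt_cfVal_gburY {n : ℕ} (hn : 1 ≤ n) : Real.goldenRatio - 1 < cfVal (gburY n) := by
  rw [cfVal_gburY hn, ← psi_goldenRatio (2 * n - 1)]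
  have := goldenRatio_bounds
  have := cfVal_pos (gburX n)
  exact psi_lt_of_odd (odd_two_mul_sub hn) Real.goldenRatio_pos (by linarith)

theorem lt_gburAlpha {n : ℕ} (hn : 2 ≤ n) : 3.19 < gburAlpha n := by
  have h1 := lt_cfVal_gburY (n := n) (by omega)
  have h2 := goldenRatio_bounds
  have h3 := cfVal_eq (gburX n)
  have h4 := (cfVal_bounds (a := fun i => gburX n (i + 1)) fun k => gburX_le_two _ _).2
  have h5 := cfVal_pos fun i => gburX n (i + 1)
  rw [gburX_get, if_pos (by omega)] at h3
  simp only [PNat.one_coe, Nat.cast_one] at h3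
  have h6 : 0.5769 ≤ cfVal (gburX n) := by
    rw [h3, le_div_iff₀ (by linarith)]
    linarith
  unfold gburAlpha
  linarith

theorem gburAlpha_lt_gburBeta {n : ℕ} (hn : 2 ≤ n) : gburAlpha n < gburBeta n := by
  obtain ⟨l, hl, hl1, hl2⟩ : ∃ l, 2 * n - 2 = l ∧ 2 * n - 1 = l + 1 ∧ 2 * n = l + 1 + 1 :=
    ⟨_, rfl, by omega, by omega⟩
  have hg := goldenRatio_bounds
  have hX := cfVal_gburX_lt n
  have hV := cfVal_betaTail_lt n
  have hX0 := cfVal_pos (gburX n)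
  have hV0 := cfVal_pos (betaTail n)
  have hW := (cfVal_bounds perTail_le_two).1
  have eX := cfVal_gburX n
  have eY := cfVal_gburY (n := n) (by omega)
  have eV := cfVal_betaTail n
  have hl' : Even l := hl ▸ even_two_mul_sub n
  rw [hl] at eX
  rw [hl1, psi_succ_eq] at eY
  rw [hl2, psi_succ_eq, psi_succ_eq] at eV
  rw [gburAlpha, gburBeta_eq]
  -- With the common prefix `1^{2n-2}` removed, `α_n^*` has the complete quotients `2 + W` (`W` the
  -- periodic tail) and `s2`, and `β_n` has `s0` twice. The harmonic mean of the first two exceeds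
  -- 1.74, while `s0 ≤ 1.7238`.
  have hs2 : 1.38195 ≤ 1 + 1 / (2 + cfVal (gburX n)) := by
    have : 0.38195 ≤ 1 / (2 + cfVal (gburX n)) := by
      rw [le_div_iff₀ (by linarith)]; linarith
    linarith
  have hs0 : 1 + 1 / (1 + 1 / (2 + cfVal (betaTail n))) ≤ 1.7238 := by
    have h1 : 0.38195 ≤ 1 / (2 + cfVal (betaTail n)) := by
      rw [le_div_iff₀ (by linarith)]; linarith
    have h2 : 1 / (1 + 1 / (2 + cfVal (betaTail n))) ≤ 0.7238 := by
      rw [div_le_iff₀ (by linarith)]; linarith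
    linarith
  have hs00 : 0 < 1 + 1 / (1 + 1 / (2 + cfVal (betaTail n))) := by positivity
  generalize 1 + 1 / (2 + cfVal (gburX n)) = s2 at *
  generalize 1 + 1 / (1 + 1 / (2 + cfVal (betaTail n))) = s0 at *
  have := psi_add_of_lt_harmonic l (r := 2 + cfVal perTail) (s := s2) (c := s0) (by linarith)
    (by linarith) hs00 (by nlinarith)
  rw [hl'.neg_one_pow, one_mul] at this
  linarith

/-! ### Minimality of the periodic tail -/

/-- Comparison with the periodic tail at the first place where the sequences differ. -/
theorem cfVal_perTail_lt {w : ℕ → ℕ+} {m : ℕ} {x : ℝ} (hx : 0 ≤ x) (hx1 : x ≤ 1)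
    (heq : ∀ i < m, w i = perTail i) (hne : w m ≠ perTail m) (h2 : w m ≤ 2)
    (hno : ∀ i, i + 3 = m → ¬ (w i = 2 ∧ w (i + 1) = 1 ∧ w (i + 2) = 2 ∧ w (i + 3) = 1)) :
    cfVal perTail < cfTail (m + 1) w x := by
  rw [cfTail_succ_last, cfVal_eq_cfTail m perTail, cfTail_congr heq,
    cfVal_eq fun i => perTail (i + m), zero_add]
  have t0 := cfVal_pos fun i => perTail (i + 1 + m)
  have t1 := cfVal_lt_one fun i => perTail (i + 1 + m)
  generalize (cfVal fun i => perTail (i + 1 + m)) = t at *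
  rcases pnat_eq_one_or_two h2 with h1 | h1
  · have hp : perTail m = 2 := by
      rcases pnat_eq_one_or_two (perTail_le_two m) with h | h
      · exact absurd (h1.trans h.symm) hne
      · exact h
    rw [h1, hp, pnat_two_coe]
    simp only [PNat.one_coe, Nat.cast_one]
    -- A change from 2 to 1 raises the value at even places. The only odd candidate is `m % 4 = 3`,
    -- where the word would read `2, 1, 2, 1`.
    have hev : Even m := by
      by_contra hodd
      rw [Nat.not_even_iff_odd, Nat.odd_iff] at hodd
      have h3 : m % 4 = 3 := by
        have : ¬ m % 4 = 1 := fun h => by simp [perTail, h] at hp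
        omega
      obtain ⟨i, rfl⟩ : ∃ i, m = i + 3 := ⟨m - 3, by omega⟩
      refine hno i rfl ⟨?_, ?_, ?_, h1⟩
      · rw [heq i (by omega), perTail, if_neg (by omega)]
      · rw [heq (i + 1) (by omega), perTail, if_pos (by omega)]
      · rw [heq (i + 2) (by omega), perTail, if_neg (by omega)]
    refine (cfTail_lt m _ (by positivity) ?_).1 hev
    exact one_div_lt_one_div_of_lt (by linarith) (by linarith)
  · have hp : perTail m = 1 := by
      rcases pnat_eq_one_or_two (perTail_le_two m) with h | h
      · exact h
      · exact absurd (h1.trans h.symm) hne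
    rw [h1, hp, pnat_two_coe]
    simp only [PNat.one_coe, Nat.cast_one]
    -- The ones of the periodic tail sit at odd places, where a change from 1 to 2 raises the value.
    have hodd : Odd m := by
      have : m % 4 = 1 := by
        by_contra h
        simp [perTail, h] at hp
      rw [Nat.odd_iff]
      omega
    refine (cfTail_lt m _ (by positivity) ?_).2 hodd
    exact one_div_lt_one_div_of_lt (by linarith) (by linarith)

theorem cfVal_perTail_lt_of_ne {w : ℕ → ℕ+} (h2 : ∀ i, w i ≤ 2)
    (hno : ∀ i, ¬ (w i = 2 ∧ w (i + 1) = 1 ∧ w (i + 2) = 2 ∧ w (i + 3) = 1))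
    (hne : w ≠ perTail) : cfVal perTail < cfVal w := by
  classical
  have hex : ∃ m, w m ≠ perTail m := Function.ne_iff.mp hne
  rw [cfVal_eq_cfTail (Nat.find hex + 1) w]
  refine cfVal_perTail_lt (cfVal_nonneg _) (cfVal_le_one _) ?_ (Nat.find_spec hex) (h2 _)
    fun i _ => hno i
  intro i hi
  have := Nat.find_min hex hi
  push Not at this
  exact this

theorem cfVal_perTail_le {w : ℕ → ℕ+} (h2 : ∀ i, w i ≤ 2)
    (hno : ∀ i, ¬ (w i = 2 ∧ w (i + 1) = 1 ∧ w (i + 2) = 2 ∧ w (i + 3) = 1)) :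
    cfVal perTail ≤ cfVal w := by
  by_cases h : w = perTail
  · rw [h]
  · exact (cfVal_perTail_lt_of_ne h2 hno h).le

/-! ### Two-sided sequences with `M(B)` small -/

/-- `[0; b_{i+1}, b_{i+2}, …]`. -/
noncomputable def rightVal (B : ℤ → ℕ+) (i : ℤ) : ℝ := cfVal fun k : ℕ => B (i + 1 + k)

/-- `[0; b_{i-1}, b_{i-2}, …]`. -/
noncomputable def leftVal (B : ℤ → ℕ+) (i : ℤ) : ℝ := cfVal fun k : ℕ => B (i - 1 - k)

theorem lam_eq (B : ℤ → ℕ+) (i : ℤ) : lam B i = ((B i : ℕ) : ℝ) + leftVal B i + rightVal B i :=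
  rfl

theorem rightVal_run {B : ℤ → ℕ+} {i : ℤ} (l : ℕ) (h : ∀ j : ℕ, j < l → B (i + 1 + j) = 1) :
    rightVal B i = psi l (((B (i + 1 + l) : ℕ) : ℝ) + rightVal B (i + 1 + l)) := by
  have e : ∀ k : ℕ, i + 1 + ((l + 1 + k : ℕ) : ℤ) = i + 1 + l + 1 + k := fun k => by
    push_cast; ring
  rw [rightVal, cfVal_eq_psi (w := fun k : ℕ => B (i + 1 + k)) l h]
  simp only [e]
  rfl

theorem leftVal_run {B : ℤ → ℕ+} {i : ℤ} (l : ℕ) (h : ∀ j : ℕ, j < l → B (i - 1 - j) = 1) :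
    leftVal B i = psi l (((B (i - 1 - l) : ℕ) : ℝ) + leftVal B (i - 1 - l)) := by
  have e : ∀ k : ℕ, i - 1 - ((l + 1 + k : ℕ) : ℤ) = i - 1 - l - 1 - k := fun k => by
    push_cast; ring
  rw [leftVal, cfVal_eq_psi (w := fun k : ℕ => B (i - 1 - k)) l h]
  simp only [e]
  rfl

/-- All `λ_i(B)` are less than `β_n`. -/
def BelowBeta (n : ℕ) (B : ℤ → ℕ+) : Prop := ∀ i, lam B i < gburBeta n

theorem BelowBeta.neg {n : ℕ} {B : ℤ → ℕ+} (h : BelowBeta n B) : BelowBeta n fun i => B (-i) :=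
  fun i => by rw [lam_neg]; exact h _

theorem BelowBeta.le_two {n : ℕ} {B : ℤ → ℕ+} (h : BelowBeta n B) (i : ℤ) : B i ≤ 2 := by
  have hb : gburBeta n < 3.24 := by
    have := cfVal_betaTail_lt n
    have := goldenRatio_bounds
    rw [gburBeta_eq]
    linarith
  have h3 : ∀ i, B i ≤ 3 := by
    intro i
    have h1 := h i
    rw [lam_eq] at h1
    have h2 : 0 < leftVal B i := cfVal_pos _
    have h4 : 0 < rightVal B i := cfVal_pos _
    by_contra hcon
    have h5 : 4 ≤ (B i : ℕ) := not_le.mp hcon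
    have h6 : (4 : ℝ) ≤ ((B i : ℕ) : ℝ) := by exact_mod_cast h5
    linarith
  have low : ∀ w : ℕ → ℕ+, (∀ k, w k ≤ 3) → 1 / 4 ≤ cfVal w := by
    intro w hw
    rw [cfVal_eq]
    have h1 : (w 0 : ℕ) ≤ 3 := hw 0
    have h2 : ((w 0 : ℕ) : ℝ) ≤ 3 := by exact_mod_cast h1
    have h4 := cfVal_le_one fun k => w (k + 1)
    have h5 := cfVal_nonneg fun k => w (k + 1)
    have h6 := one_le_pnat (w 0)
    exact one_div_le_one_div_of_le (by linarith) (by linarith)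
  have h1 := h i
  rw [lam_eq] at h1
  have h2 : 1 / 4 ≤ leftVal B i := low _ fun k => h3 _
  have h4 : 1 / 4 ≤ rightVal B i := low _ fun k => h3 _
  by_contra hcon
  have h5 : 3 ≤ (B i : ℕ) := not_le.mp hcon
  have h6 : (3 : ℝ) ≤ ((B i : ℕ) : ℝ) := by exact_mod_cast h5
  linarith

theorem rightVal_bounds {B : ℤ → ℕ+} (h : ∀ i, B i ≤ 2) (i : ℤ) :
    4 / 11 ≤ rightVal B i ∧ rightVal B i ≤ 11 / 15 := cfVal_bounds fun _ => h _

theorem leftVal_bounds {B : ℤ → ℕ+} (h : ∀ i, B i ≤ 2) (i : ℤ) :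
    4 / 11 ≤ leftVal B i ∧ leftVal B i ≤ 11 / 15 := cfVal_bounds fun _ => h _

theorem rightVal_neg (B : ℤ → ℕ+) (i : ℤ) : rightVal (fun k => B (-k)) i = leftVal B (-i) := by
  unfold leftVal rightVal
  have e1 : ∀ k : ℕ, -(i + 1 + k) = -i - 1 - (k : ℤ) := fun k => by ring
  simp only [e1]

/-- A maximal block of ones of odd length next to a `2` is longer than the block on the other
side. -/
theorem BelowBeta.not_odd_run {n : ℕ} {B : ℤ → ℕ+} (h : BelowBeta n B) (i : ℤ) (h0 : B i = 2) {k : ℕ}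
    (hk : Odd k) (hr : ∀ j : ℕ, j < k → B (i + 1 + j) = 1) (hr2 : B (i + 1 + k) = 2)
    (hl : ∀ j : ℕ, j < k → B (i - 1 - j) = 1) : False := by
  have h1 := h i
  rw [lam_eq, h0, rightVal_run k hr, hr2, leftVal_run k hl, pnat_two_coe, gburBeta_eq] at h1
  have hb := cfVal_betaTail_lt n
  have hg := goldenRatio_bounds
  have b1 := rightVal_bounds h.le_two (i + 1 + k)
  have b2 := leftVal_bounds h.le_two (i - 1 - k)
  have b3 := one_le_pnat (B (i - 1 - k))
  set r := 2 + rightVal B (i + 1 + k)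
  set t := ((B (i - 1 - k) : ℕ) : ℝ) + leftVal B (i - 1 - k)
  have hr' : 26 / 11 ≤ r := by linarith
  have ht' : 15 / 11 ≤ t := by linarith
  -- The harmonic mean of 26/11 and 15/11 is about 1.729, above `φ`; as `k` is odd, the two sides
  -- sum to more than `2(φ - 1)`, which exceeds `β_n - 2`.
  have := psi_add_of_lt_harmonic k (r := r) (s := t) (c := Real.goldenRatio) (by linarith)
    (by linarith) Real.goldenRatio_pos (by nlinarith)
  rw [hk.neg_one_pow, psi_goldenRatio] at this
  linarith

theorem BelowBeta.not_odd_run' {n : ℕ} {B : ℤ → ℕ+} (h : BelowBeta n B) (i : ℤ) (h0 : B i = 2) {k : ℕ}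
    (hk : Odd k) (hl : ∀ j : ℕ, j < k → B (i - 1 - j) = 1) (hl2 : B (i - 1 - k) = 2)
    (hr : ∀ j : ℕ, j < k → B (i + 1 + j) = 1) : False := by
  have e1 : ∀ j : ℤ, -(-i + 1 + j) = i - 1 - j := fun j => by ring
  have e2 : ∀ j : ℤ, -(-i - 1 - j) = i + 1 + j := fun j => by ring
  refine h.neg.not_odd_run (-i) (by simpa using h0) hk ?_ ?_ ?_
  · intro j hj; simpa only [e1] using hl j hj
  · simpa only [e1] using hl2
  · intro j hj; simpa only [e2] using hr j hj

/-- The case of a block of length one, seen from the second 2. -/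
theorem BelowBeta.not_2121 {n : ℕ} {B : ℤ → ℕ+} (h : BelowBeta n B) (i : ℤ) :
    ¬ (B i = 2 ∧ B (i + 1) = 1 ∧ B (i + 2) = 2 ∧ B (i + 3) = 1) := by
  rintro ⟨h0, h1, h2, h3⟩
  refine h.not_odd_run' (i + 2) h2 odd_one ?_ ?_ ?_
  · intro j hj
    obtain rfl : j = 0 := by omega
    rw [← h1]; congr 1; push_cast; ring
  · rw [← h0]; congr 1; push_cast; ring
  · intro j hj
    obtain rfl : j = 0 := by omega
    rw [← h3]; congr 1; push_cast; ring

/-- A `2` is not surrounded by blocks of `2n` ones on both sides. -/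
theorem BelowBeta.not_both_long {n : ℕ} {B : ℤ → ℕ+} (h : BelowBeta n B) (i : ℤ) (h0 : B i = 2)
    (hr : ∀ j : ℕ, j < 2 * n → B (i + 1 + j) = 1) (hl : ∀ j : ℕ, j < 2 * n → B (i - 1 - j) = 1) :
    False := by
  generalize hN : 2 * n = N at hr hl
  have h1 := h i
  have hev : Even N := hN ▸ even_two_mul n
  have er := rightVal_run N hr
  have el := leftVal_run N hl
  rw [lam_eq, h0, pnat_two_coe, gburBeta_eq] at h1
  have eV := cfVal_betaTail n
  rw [hN] at eV
  have hV := (cfVal_bounds (betaTail_le_two n)).1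
  obtain ⟨b1, b1'⟩ := rightVal_bounds h.le_two (i + 1 + (N : ℕ))
  obtain ⟨b2, b2'⟩ := leftVal_bounds h.le_two (i - 1 - (N : ℕ))
  have o1 := one_le_pnat (B (i + 1 + (N : ℕ)))
  have o2 := one_le_pnat (B (i - 1 - (N : ℕ)))
  -- The even block makes the sum of the two sides large unless the complete quotients beyond it
  -- have mean above that of the `β_n` sequence. This forces both outer digits to be 2.
  have hsum : 2 * (2 + cfVal (betaTail n)) <
      (((B (i + 1 + (N : ℕ)) : ℕ) : ℝ) + rightVal B (i + 1 + (N : ℕ))) +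
      (((B (i - 1 - (N : ℕ)) : ℕ) : ℝ) + leftVal B (i - 1 - (N : ℕ))) := by
    by_contra hcon
    push Not at hcon
    have := psi_add_of_mean_le N (by linarith) (by linarith) hcon
    rw [hev.neg_one_pow, ← er, ← el, ← eV] at this
    linarith
  have r2 : B (i + 1 + (N : ℕ)) = 2 := by
    rcases pnat_eq_one_or_two (h.le_two (i + 1 + (N : ℕ))) with h2 | h2
    · exfalso
      rw [h2] at hsum
      simp only [PNat.one_coe, Nat.cast_one] at hsum
      have := pnat_cast_le_two (h.le_two (i - 1 - (N : ℕ)))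
      linarith
    · exact h2
  have l2 : B (i - 1 - (N : ℕ)) = 2 := by
    rcases pnat_eq_one_or_two (h.le_two (i - 1 - (N : ℕ))) with h2 | h2
    · exfalso
      rw [h2] at hsum
      simp only [PNat.one_coe, Nat.cast_one] at hsum
      have := pnat_cast_le_two (h.le_two (i + 1 + (N : ℕ)))
      linarith
    · exact h2
  have n1 := h (i + 1 + (N : ℕ))
  have n2 := h (i - 1 - (N : ℕ))
  have e1 := leftVal_run (B := B) (i := i + 1 + (N : ℕ)) N (by
    intro j hj
    rw [← hr (N - 1 - j) (by omega)]
    congr 1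
    omega)
  have e2 := rightVal_run (B := B) (i := i - 1 - (N : ℕ)) N (by
    intro j hj
    rw [← hl (N - 1 - j) (by omega)]
    congr 1
    omega)
  rw [show (i + 1 + (N : ℕ) - 1 - (N : ℕ) : ℤ) = i by ring, h0, pnat_two_coe] at e1
  rw [show (i - 1 - (N : ℕ) + 1 + (N : ℕ) : ℤ) = i by ring, h0, pnat_two_coe] at e2
  rw [lam_eq, r2, pnat_two_coe, gburBeta_eq, e1] at n1
  rw [lam_eq, l2, pnat_two_coe, gburBeta_eq, e2] at n2
  rw [r2, l2, pnat_two_coe] at hsum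
  have p1 := leftVal_bounds h.le_two i
  have p2 := rightVal_bounds h.le_two i
  -- Adding the bounds at the two outer 2's and using `hsum` for their outward parts, the inward
  -- parts sum to less than twice the `β_n` tail. But the values at `i` have mean below that tail,
  -- so the inward parts sum to at least twice it.
  have := psi_add_of_mean_le N (r := 2 + leftVal B i) (s := 2 + rightVal B i)
    (c := 2 + cfVal (betaTail n)) (by linarith) (by linarith) (by linarith)
  rw [hev.neg_one_pow, ← eV] at this
  linarith

/-- After an even block the value decreases in the complete quotient. A shorter block is followed by
a 2 where X still has a 1; at full length what follows the 2 is at least the periodic tail, by its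
minimality. -/
theorem BelowBeta.rightVal_le_of_even_run {n : ℕ} {B : ℤ → ℕ+} (h : BelowBeta n B) (i : ℤ) {l : ℕ}
    (hl : Even l) (hln : l ≤ 2 * n - 2) (hr : ∀ j : ℕ, j < l → B (i + 1 + j) = 1)
    (hr2 : B (i + 1 + l) = 2) :
    rightVal B i ≤ cfVal (gburX n) ∧
      (rightVal B i = cfVal (gburX n) → ∀ k : ℕ, B (i + 1 + k) = gburX n k) := by
  have b1 := rightVal_bounds h.le_two (i + 1 + l)
  refine ⟨?_, fun he k => congrFun (cfVal_injective he) k⟩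
  rw [rightVal_run l hr, hr2, pnat_two_coe]
  rcases hln.lt_or_eq with hlt | heq
  · rw [cfVal_eq_psi (w := gburX n) l fun i hi => by rw [gburX_get, if_pos (by omega)]]
    rw [gburX_get, if_pos hlt]
    have := cfVal_lt_one fun i => gburX n (l + 1 + i)
    have := cfVal_pos fun i => gburX n (l + 1 + i)
    simp only [PNat.one_coe, Nat.cast_one]
    exact psi_le_of_even hl (by linarith) (by linarith)
  · rw [cfVal_gburX, ← heq]
    have := cfVal_pos perTail
    refine psi_le_of_even hl (by linarith) ?_
    have : cfVal perTail ≤ rightVal B (i + 1 + l) := by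
      refine cfVal_perTail_le (fun k => h.le_two _) fun k hk => ?_
      refine h.not_2121 (i + 1 + l + 1 + k) ?_
      obtain ⟨k0, k1, k2, k3⟩ := hk
      push_cast at k1 k2 k3
      refine ⟨k0, ?_, ?_, ?_⟩
      · rw [← k1]; congr 1; ring
      · rw [← k2]; congr 1; ring
      · rw [← k3]; congr 1; ring
    linarith

theorem exists_run {B : ℤ → ℕ+} (h : ∀ i, B i ≤ 2) (i : ℤ) :
    (∀ j : ℕ, B (i + 1 + j) = 1) ∨
      ∃ l : ℕ, (∀ j : ℕ, j < l → B (i + 1 + j) = 1) ∧ B (i + 1 + l) = 2 := by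
  classical
  by_cases hex : ∃ l : ℕ, B (i + 1 + l) = 2
  · refine Or.inr ⟨Nat.find hex, fun j hj => ?_, Nat.find_spec hex⟩
    exact (pnat_eq_one_or_two (h _)).resolve_right (Nat.find_min hex hj)
  · push Not at hex
    exact Or.inl fun j => (pnat_eq_one_or_two (h _)).resolve_right (hex j)

theorem BelowBeta.leftVal_le_of_even_run {n : ℕ} {B : ℤ → ℕ+} (h : BelowBeta n B) (i : ℤ) {l : ℕ}
    (hl : Even l) (hln : l ≤ 2 * n - 2) (hr : ∀ j : ℕ, j < l → B (i - 1 - j) = 1)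
    (hr2 : B (i - 1 - l) = 2) :
    leftVal B i ≤ cfVal (gburX n) ∧
      (leftVal B i = cfVal (gburX n) → ∀ k : ℕ, B (i - 1 - k) = gburX n k) := by
  have e1 : ∀ j : ℤ, -(-i + 1 + j) = i - 1 - j := fun j => by ring
  have := h.neg.rightVal_le_of_even_run (-i) hl hln (by simpa only [e1] using hr)
    (by simpa only [e1] using hr2)
  rw [rightVal_neg, neg_neg] at this
  simpa only [e1] using this

/-- After `2, 1^{2n-1}, 2` the continuation is at most `X`. -/
theorem BelowBeta.rightVal_le_of_odd_left {n : ℕ} (hn : 1 ≤ n) {B : ℤ → ℕ+} (h : BelowBeta n B)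
    (i : ℤ) (h0 : B i = 2) (hl : ∀ j : ℕ, j < 2 * n - 1 → B (i - 1 - j) = 1)
    (hl2 : B (i - 1 - (2 * n - 1 : ℕ)) = 2) :
    rightVal B i ≤ cfVal (gburX n) ∧
      (rightVal B i = cfVal (gburX n) → ∀ k : ℕ, B (i + 1 + k) = gburX n k) := by
  rcases exists_run h.le_two i with hr | ⟨m, hm, hm2⟩
  · exact (h.not_odd_run' i h0 (odd_two_mul_sub hn) hl hl2 fun j _ => hr j).elim
  · by_cases hlong : 2 * n - 1 ≤ m
    · exact (h.not_odd_run' i h0 (odd_two_mul_sub hn) hl hl2 fun j hj => hm j (by omega)).elim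
    · rcases Nat.even_or_odd m with hev | hodd
      · exact h.rightVal_le_of_even_run i hev (by omega) hm hm2
      · exact (h.not_odd_run i h0 hodd hm hm2 fun j hj => hl j (by omega)).elim

/-- If a 2 follows the `2n-2` ones, the value is below `φ - 1`, hence below Y. Otherwise there are
`2n-1` ones, an odd number, so the value increases in the complete quotient; the largest case is a 2
continued by X. -/
theorem BelowBeta.rightVal_le_of_long_right {n : ℕ} (hn : 1 ≤ n) {B : ℤ → ℕ+} (h : BelowBeta n B)
    (i : ℤ) (h0 : B i = 2) (hr : ∀ j : ℕ, j < 2 * n - 2 → B (i + 1 + j) = 1) :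
    rightVal B i ≤ cfVal (gburY n) ∧
      (rightVal B i = cfVal (gburY n) → ∀ k : ℕ, B (i + 1 + k) = gburY n k) := by
  refine ⟨?_, fun he k => congrFun (cfVal_injective he) k⟩
  have hg := goldenRatio_bounds
  rcases pnat_eq_one_or_two (h.le_two (i + 1 + (2 * n - 2 : ℕ))) with h1 | h1
  · have hr' : ∀ j : ℕ, j < 2 * n - 1 → B (i + 1 + j) = 1 := fun j hj => by
      rcases (by omega : j < 2 * n - 2 ∨ j = 2 * n - 2) with h2 | rfl
      · exact hr j h2
      · exact h1
    have e := rightVal_run (2 * n - 1) hr'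
    have b := rightVal_bounds h.le_two (i + 1 + (2 * n - 1 : ℕ))
    have o := one_le_pnat (B (i + 1 + (2 * n - 1 : ℕ)))
    rw [e, cfVal_gburY hn]
    refine psi_le_of_odd (odd_two_mul_sub hn) (by linarith) ?_
    have hX := cfVal_pos (gburX n)
    rcases pnat_eq_one_or_two (h.le_two (i + 1 + (2 * n - 1 : ℕ))) with h2 | h2
    · rw [h2]
      simp only [PNat.one_coe, Nat.cast_one]
      linarith
    · rw [h2, pnat_two_coe]
      have := (h.rightVal_le_of_odd_left hn (i + 1 + (2 * n - 1 : ℕ)) h2 (by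
        intro j hj
        rw [← hr' (2 * n - 1 - 1 - j) (by omega)]
        congr 1
        omega) (by rw [← h0]; congr 1; ring)).1
      linarith
  · have hY := lt_cfVal_gburY hn
    have e := rightVal_run (2 * n - 2) hr
    have b := rightVal_bounds h.le_two (i + 1 + (2 * n - 2 : ℕ))
    rw [h1, pnat_two_coe] at e
    have := psi_lt_of_even (even_two_mul_sub n) Real.goldenRatio_pos
      (show Real.goldenRatio < 2 + rightVal B (i + 1 + (2 * n - 2 : ℕ)) by linarith)
    rw [psi_goldenRatio] at this
    linarith

/-- The bound `λ_i(B) ≤ α_n^*` when the block of ones on the left is the shorter one. -/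
theorem BelowBeta.lam_le_of_left_run {n : ℕ} (hn : 1 ≤ n) {B : ℤ → ℕ+} (h : BelowBeta n B) (i : ℤ)
    (h0 : B i = 2) {l : ℕ} (hl : ∀ j : ℕ, j < l → B (i - 1 - j) = 1) (hl2 : B (i - 1 - l) = 2)
    (hr : ∀ j : ℕ, j < l → B (i + 1 + j) = 1) :
    lam B i ≤ gburAlpha n ∧ (lam B i = gburAlpha n →
      (∀ k : ℕ, B (i - 1 - k) = gburX n k) ∧ ∀ k : ℕ, B (i + 1 + k) = gburY n k) := by
  have hev : Even l := by
    by_contra hcon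
    rw [Nat.not_even_iff_odd] at hcon
    exact h.not_odd_run' i h0 hcon hl hl2 hr
  have hle : l ≤ 2 * n - 2 := by
    by_contra hcon
    have : 2 * n ≤ l := by
      obtain ⟨m, rfl⟩ := hev
      omega
    exact h.not_both_long i h0 (fun j hj => hr j (by omega)) fun j hj => hl j (by omega)
  obtain ⟨hX, hXe⟩ := h.leftVal_le_of_even_run i hev hle hl hl2
  rw [lam_eq, h0, pnat_two_coe, gburAlpha]
  rcases hle.lt_or_eq with hlt | rfl
  · have hg := goldenRatio_bounds
    have hY := lt_cfVal_gburY hn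
    have er := rightVal_run l hr
    have el := leftVal_run l hl
    have br := rightVal_bounds h.le_two (i + 1 + l)
    have bl := leftVal_bounds h.le_two (i - 1 - l)
    have o := one_le_pnat (B (i + 1 + l))
    rw [hl2, pnat_two_coe] at el
    have eX := cfVal_eq_psi (w := gburX n) l fun i hi => by rw [gburX_get, if_pos (by omega)]
    rw [gburX_get, if_pos hlt] at eX
    have bX := cfVal_bounds (a := fun i => gburX n (l + 1 + i)) fun k => gburX_le_two _ _
    simp only [PNat.one_coe, Nat.cast_one] at eX
    set r := ((B (i + 1 + l) : ℕ) : ℝ) + rightVal B (i + 1 + l)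
    set s := 2 + leftVal B (i - 1 - l)
    set t := 1 + cfVal fun i => gburX n (l + 1 + i)
    have hr' : 15 / 11 ≤ r := by linarith
    have hs' : 26 / 11 ≤ s := by linarith
    -- The constant 1.7 separates the harmonic mean of 15/11 and 26/11 (about 1.729) from the mean
    -- of `φ` and `t ≤ 26/15` (about 1.676). Here X is `psi l t`, and Y exceeds `psi l φ`.
    have k1 := psi_add_of_lt_harmonic l (r := r) (s := s) (c := 1.7) (by linarith) (by linarith)
      (by norm_num) (by nlinarith)
    have k2 := psi_add_of_mean_le l (r := t) (s := Real.goldenRatio) (c := 1.7) (by linarith)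
      Real.goldenRatio_pos (by linarith)
    rw [hev.neg_one_pow, one_mul] at k1 k2
    rw [psi_goldenRatio] at k2
    have : 2 + leftVal B i + rightVal B i < 2 + cfVal (gburX n) + cfVal (gburY n) := by linarith
    exact ⟨this.le, fun he => absurd he this.ne⟩
  · obtain ⟨hY, hYe⟩ := h.rightVal_le_of_long_right hn i h0 hr
    refine ⟨by linarith, fun he => ⟨hXe (by linarith), hYe (by linarith)⟩⟩

theorem gburSeq_zero (n : ℕ) : gburSeq n 0 = 2 := rfl

theorem gburSeq_right (n k : ℕ) : gburSeq n (0 + 1 + k) = gburY n k := by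
  rw [show (0 + 1 + k : ℤ) = Int.ofNat (k + 1) by simp; ring]
  rfl

theorem gburSeq_left (n k : ℕ) : gburSeq n (0 - 1 - k) = gburX n k := by
  rw [show (0 - 1 - k : ℤ) = Int.negSucc k by rw [Int.negSucc_eq]; ring]
  rfl

theorem eq_gburSeq {n : ℕ} {B : ℤ → ℕ+} (h0 : B 0 = 2) (hl : ∀ k : ℕ, B (0 - 1 - k) = gburX n k)
    (hr : ∀ k : ℕ, B (0 + 1 + k) = gburY n k) : B = gburSeq n := by
  funext i
  rcases lt_trichotomy i 0 with h | rfl | h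
  · obtain ⟨k, rfl⟩ : ∃ k : ℕ, i = 0 - 1 - k := ⟨(-i - 1).toNat, by omega⟩
    rw [hl, gburSeq_left]
  · exact h0
  · obtain ⟨k, rfl⟩ : ∃ k : ℕ, i = 0 + 1 + k := ⟨(i - 1).toNat, by omega⟩
    rw [hr, gburSeq_right]

/-- Among the sequences all of whose `λ_i` are below `β_n`, the largest value is `α_n^*`, and it
is taken only by Gbur's sequence and its reflection. -/
theorem BelowBeta.lam_zero_le {n : ℕ} (hn : 2 ≤ n) {B : ℤ → ℕ+} (h : BelowBeta n B) :
    lam B 0 ≤ gburAlpha n ∧ (lam B 0 = gburAlpha n →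
      B = gburSeq n ∨ B = fun i => gburSeq n (-i)) := by
  have hn1 : 1 ≤ n := by omega
  rcases pnat_eq_one_or_two (h.le_two 0) with h0 | h0
  · have h1 := lt_gburAlpha hn
    have h2 := rightVal_bounds h.le_two 0
    have h3 := leftVal_bounds h.le_two 0
    have : lam B 0 < gburAlpha n := by
      rw [lam_eq, h0]
      simp only [PNat.one_coe, Nat.cast_one]
      linarith
    exact ⟨this.le, fun he => absurd he this.ne⟩
  have left : ∀ {B : ℤ → ℕ+}, BelowBeta n B → B 0 = 2 → ∀ l : ℕ,
      (∀ j : ℕ, j < l → B (0 - 1 - j) = 1) → B (0 - 1 - l) = 2 →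
      (∀ j : ℕ, j < l → B (0 + 1 + j) = 1) →
      lam B 0 ≤ gburAlpha n ∧ (lam B 0 = gburAlpha n → B = gburSeq n) := by
    intro B h h0 l hl hl2 hr
    obtain ⟨h1, h2⟩ := h.lam_le_of_left_run hn1 0 h0 hl hl2 hr
    exact ⟨h1, fun he => eq_gburSeq h0 (h2 he).1 (h2 he).2⟩
  have right : ∀ l : ℕ, (∀ j : ℕ, j < l → B (0 + 1 + j) = 1) → B (0 + 1 + l) = 2 →
      (∀ j : ℕ, j < l → B (0 - 1 - j) = 1) →
      lam B 0 ≤ gburAlpha n ∧ (lam B 0 = gburAlpha n → B = fun i => gburSeq n (-i)) := by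
    intro l hr hr2 hl
    have e1 : ∀ j : ℤ, -(0 - 1 - j) = 0 + 1 + j := fun j => by ring
    have e2 : ∀ j : ℤ, -(0 + 1 + j) = 0 - 1 - j := fun j => by ring
    obtain ⟨h1, h2⟩ := left h.neg (by simpa using h0) l (by simpa only [e1] using hr)
      (by simpa only [e1] using hr2) (by simpa only [e2] using hl)
    rw [lam_neg, neg_zero] at h1 h2
    refine ⟨h1, fun he => ?_⟩
    rw [← h2 he]
    funext i
    simp
  have e1 : ∀ j : ℤ, -(-0 + 1 + j) = 0 - 1 - j := fun j => by ring
  have hleft := exists_run (B := fun k => B (-k)) (fun k => h.le_two _) (-0)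
  simp only [e1] at hleft
  rcases exists_run h.le_two 0 with hr | ⟨k, hk, hk2⟩ <;> rcases hleft with hl | ⟨l, hl, hl2⟩
  · exact (h.not_both_long 0 h0 (fun j _ => hr j) fun j _ => hl j).elim
  · obtain ⟨h1, h2⟩ := left h h0 l hl hl2 fun j _ => hr j
    exact ⟨h1, fun he => Or.inl (h2 he)⟩
  · obtain ⟨h1, h2⟩ := right k hk hk2 fun j _ => hl j
    exact ⟨h1, fun he => Or.inr (h2 he)⟩
  · rcases le_total l k with hlk | hkl
    · obtain ⟨h1, h2⟩ := left h h0 l hl hl2 fun j hj => hk j (by omega)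
      exact ⟨h1, fun he => Or.inl (h2 he)⟩
    · obtain ⟨h1, h2⟩ := right k hk hk2 fun j hj => hl j (by omega)
      exact ⟨h1, fun he => Or.inr (h2 he)⟩

/-! ### Gbur's sequence -/

/-- Describes the digits by linear conditions and congruences modulo 4, which puts symmetry,
isolated 2's and window matching within reach of `omega`. -/
theorem gburSeq_get {n : ℕ} (hn : 1 ≤ n) (i : ℤ) : gburSeq n i =
    if (2 - 2 * n ≤ i ∧ i ≤ -1) ∨ (1 ≤ i ∧ i ≤ 2 * n - 1) ∨ (2 * n + 1 ≤ i ∧ i ≤ 4 * n - 2) ∨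
      (4 * n - 1 ≤ i ∧ (i - (4 * n - 1)) % 4 = 2) ∨
      (i ≤ 1 - 2 * n ∧ (1 - 2 * n - i) % 4 = 2) then 1 else 2 := by
  rcases lt_trichotomy i 0 with h | rfl | h
  · obtain ⟨k, rfl⟩ : ∃ k : ℕ, i = 0 - 1 - k := ⟨(-i - 1).toNat, by omega⟩
    rw [gburSeq_left, gburX_get]
    split_ifs <;> first | rfl | omega
  · rw [gburSeq_zero, if_neg (by omega)]
  · obtain ⟨k, rfl⟩ : ∃ k : ℕ, i = 0 + 1 + k := ⟨(i - 1).toNat, by omega⟩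
    rw [gburSeq_right, gburY_get hn, gburX_get]
    split_ifs <;> first | rfl | omega

theorem gburSeq_eq_one_iff {n : ℕ} (hn : 1 ≤ n) (i : ℤ) : gburSeq n i = 1 ↔
    (2 - 2 * n ≤ i ∧ i ≤ -1) ∨ (1 ≤ i ∧ i ≤ 2 * n - 1) ∨ (2 * n + 1 ≤ i ∧ i ≤ 4 * n - 2) ∨
      (4 * n - 1 ≤ i ∧ (i - (4 * n - 1)) % 4 = 2) ∨
      (i ≤ 1 - 2 * n ∧ (1 - 2 * n - i) % 4 = 2) := by
  rw [gburSeq_get hn]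
  split_ifs with h
  · exact iff_of_true rfl h
  · exact iff_of_false (by decide) h

theorem gburSeq_le_two {n : ℕ} (hn : 1 ≤ n) (i : ℤ) : gburSeq n i ≤ 2 := by
  rw [gburSeq_get hn]
  split_ifs <;> decide

theorem pnat_eq_of_one_iff {b c : ℕ+} (hb : b ≤ 2) (hc : c ≤ 2) (h : b = 1 ↔ c = 1) : b = c := by
  rcases pnat_eq_one_or_two hb with h1 | h1
  · rw [h1, h.mp h1]
  · rcases pnat_eq_one_or_two hc with h2 | h2
    · rw [h2, h.mpr h2]
    · rw [h1, h2]

theorem ne_one_of_eq_two {b : ℕ+} (h : b = 2) : b ≠ 1 := by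
  rw [h]; decide

/-- Gbur's sequence is symmetric about the index `n`. -/
theorem gburSeq_add_two_mul {n : ℕ} (hn : 1 ≤ n) (i : ℤ) :
    gburSeq n (i + 2 * n) = gburSeq n (-i) := by
  refine pnat_eq_of_one_iff (gburSeq_le_two hn _) (gburSeq_le_two hn _) ?_
  rw [gburSeq_eq_one_iff hn, gburSeq_eq_one_iff hn]
  omega

theorem lam_gburSeq_zero (n : ℕ) : lam (gburSeq n) 0 = gburAlpha n := by
  rw [lam_eq, leftVal, rightVal]
  simp only [gburSeq_left, gburSeq_right, gburSeq_zero, pnat_two_coe]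
  rfl

theorem lam_gburSeq_two_mul {n : ℕ} (hn : 1 ≤ n) :
    lam (gburSeq n) (0 + 2 * n) = gburAlpha n := by
  rw [← lam_shift]
  simp only [gburSeq_add_two_mul hn]
  rw [lam_neg, neg_zero, lam_gburSeq_zero]

/-- `λ_i` is small unless `b_i` is a `2` between two ones. -/
theorem lam_lt_of_not_isolated {B : ℤ → ℕ+} (h : ∀ i, B i ≤ 2) (i : ℤ)
    (hi : ¬ (B i = 2 ∧ B (i + 1) = 1 ∧ B (i - 1) = 1)) : lam B i < 3.157 := by
  have h1 := rightVal_bounds h i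
  have h2 := leftVal_bounds h i
  have h3 := pnat_cast_le_two (h i)
  rw [lam_eq]
  by_cases h0 : B i = 1
  · rw [h0]
    simp only [PNat.one_coe, Nat.cast_one]
    linarith
  have h0' := (pnat_eq_one_or_two (h i)).resolve_left h0
  by_cases hr : B (i + 1) = 1
  · have hl := (pnat_eq_one_or_two (h (i - 1))).resolve_left fun hl => hi ⟨h0', hr, hl⟩
    have e := leftVal_run (B := B) (i := i) 0 (by simp)
    have b := leftVal_bounds h (i - 1)
    rw [Nat.cast_zero, sub_zero, hl, pnat_two_coe] at e
    have : leftVal B i ≤ 11 / 26 := by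
      rw [e, psi, div_le_iff₀ (by linarith)]
      linarith
    linarith
  · have hr := (pnat_eq_one_or_two (h (i + 1))).resolve_left hr
    have e := rightVal_run (B := B) (i := i) 0 (by simp)
    have b := rightVal_bounds h (i + 1)
    rw [Nat.cast_zero, add_zero, hr, pnat_two_coe] at e
    have : rightVal B i ≤ 11 / 26 := by
      rw [e, psi, div_le_iff₀ (by linarith)]
      linarith
    linarith

theorem gburSeq_isolated {n : ℕ} (hn : 1 ≤ n) {i : ℤ} (h0 : gburSeq n i = 2)
    (h1 : gburSeq n (i + 1) = 1) (h2 : gburSeq n (i - 1) = 1) : i = 0 ∨ i = 0 + 2 * n := by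
  have h0 := ne_one_of_eq_two h0
  rw [Ne, gburSeq_eq_one_iff hn] at h0
  rw [gburSeq_eq_one_iff hn] at h1 h2
  omega

theorem lam_gburSeq_le {n : ℕ} (hn : 2 ≤ n) (i : ℤ) : lam (gburSeq n) i ≤ gburAlpha n := by
  have hn1 : 1 ≤ n := by omega
  by_cases h : gburSeq n i = 2 ∧ gburSeq n (i + 1) = 1 ∧ gburSeq n (i - 1) = 1
  · rcases gburSeq_isolated hn1 h.1 h.2.1 h.2.2 with rfl | rfl
    · exact (lam_gburSeq_zero n).le
    · exact (lam_gburSeq_two_mul hn1).le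
  · have h1 := lam_lt_of_not_isolated (gburSeq_le_two hn1) i h
    have h2 := lt_gburAlpha hn
    linarith

theorem realizes_of_lam {B : ℤ → ℕ+} {a : ℝ} (h0 : lam B 0 = a) (h : ∀ i, lam B i ≤ a) :
    Realizes B a := by
  refine ⟨h0, le_antisymm (iSup_le fun i => EReal.coe_le_coe_iff.mpr (h i)) ?_⟩
  rw [← h0]
  exact le_iSup (fun i => (lam B i : EReal)) 0

theorem Realizes.lam_le {B : ℤ → ℕ+} {a : ℝ} (h : Realizes B a) (i : ℤ) : lam B i ≤ a := by
  rw [← EReal.coe_le_coe_iff, ← h.2]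
  exact le_iSup (fun i => (lam B i : EReal)) i

theorem realizes_gburAlpha_iff {n : ℕ} (hn : 2 ≤ n) (B : ℤ → ℕ+) :
    Realizes B (gburAlpha n) ↔ B = gburSeq n ∨ B = fun i => gburSeq n (-i) := by
  constructor
  · intro h
    have hb : BelowBeta n B := fun i => (h.lam_le i).trans_lt (gburAlpha_lt_gburBeta hn)
    exact (hb.lam_zero_le hn).2 h.1
  · rintro (rfl | rfl)
    · exact realizes_of_lam (lam_gburSeq_zero n) (lam_gburSeq_le hn)
    · refine realizes_of_lam ?_ fun i => ?_
      · rw [lam_neg, neg_zero, lam_gburSeq_zero]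
      · rw [lam_neg]
        exact lam_gburSeq_le hn _

theorem not_isPurelyPeriodic_gburSeq {n : ℕ} (hn : 2 ≤ n) : ¬ IsPurelyPeriodic (gburSeq n) := by
  rintro ⟨p, hp, h⟩
  have hn1 : 1 ≤ n := by omega
  have hm : ∀ (m : ℕ) (i : ℤ), gburSeq n (i + m * p) = gburSeq n i := by
    intro m i
    induction m with
    | zero => simp
    | succ m ih => rw [← ih, ← h (i + m * p)]; congr 1; push_cast; ring
  have h1 : gburSeq n (-1) = 1 := (gburSeq_eq_one_iff hn1 _).mpr (by omega)
  have h2 : gburSeq n (-2) = 1 := (gburSeq_eq_one_iff hn1 _).mpr (by omega)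
  -- A shift by `4n + 1` periods carries the adjacent ones at `-1` and `-2` into the right periodic
  -- tail, which has no two adjacent ones.
  rw [← hm (4 * n + 1), gburSeq_eq_one_iff hn1] at h1 h2
  have : ((4 * n + 1 : ℕ) : ℤ) ≤ (4 * n + 1 : ℕ) * p := by
    exact_mod_cast Nat.le_mul_of_pos_right _ hp
  generalize ((4 * n + 1 : ℕ) : ℤ) * p = q at *
  push_cast at this
  omega

theorem IsPurelyPeriodic.neg {B : ℤ → ℕ+} (h : IsPurelyPeriodic B) :
    IsPurelyPeriodic fun i => B (-i) := by
  obtain ⟨p, hp, h⟩ := h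
  refine ⟨p, hp, fun i => ?_⟩
  change B (-(i + p)) = B (-i)
  rw [← h (-(i + p))]
  congr 1
  ring

/-! ### The gap -/

theorem exists_belowBeta_limit {n : ℕ} {a : ℕ → ℕ+} {l : ℝ} (hl : l < gburBeta n)
    (hfin : ∀ c, l < c → {k | c ≤ lamNat a k}.Finite) {U : Ultrafilter ℕ}
    (hU : (U : Filter ℕ) ≤ atTop) :
    ∃ B : ℤ → ℕ+, (∀ j : ℤ, ∀ᶠ k : ℕ in U, a ((k : ℤ) + j).toNat = B j) ∧
      (∀ i, lam B i ≤ l) ∧ BelowBeta n B := by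
  have hev : ∀ c, l < c → ∀ᶠ k in atTop, lamNat a k < c := by
    intro c hc
    rw [← Nat.cofinite_eq_atTop, eventually_cofinite]
    simpa using hfin c hc
  obtain ⟨B, hB⟩ := exists_limit_of_eventually_lt (hev _ hl) U hU
  have hle : ∀ i, lam B i ≤ l := fun i =>
    le_of_forall_gt_imp_ge_of_dense fun c hc => lam_le_of_limit (hev c hc) hU hB i
  exact ⟨B, hB, hle, fun i => (hle i).trans_lt hl⟩

theorem le_lam_of_limit {a : ℕ → ℕ+} {c : ℝ} {U : Ultrafilter ℕ} (hU : (U : Filter ℕ) ≤ atTop)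
    (hK : {k | c ≤ lamNat a k} ∈ U) {B : ℤ → ℕ+}
    (hB : ∀ j : ℤ, ∀ᶠ k : ℕ in U, a ((k : ℤ) + j).toNat = B j) : c ≤ lam B 0 :=
  ge_of_tendsto (tendsto_lamNat hU hB) hK

theorem disjoint_gap_lagrangeSpectrum {n : ℕ} (hn : 2 ≤ n) :
    Disjoint (Set.Ioo (gburAlpha n) (gburBeta n)) lagrangeSpectrum := by
  rw [Set.disjoint_left]
  rintro l ⟨h1, h2⟩ ⟨α, hα, hl⟩
  have h3 := lt_gburAlpha hn
  obtain ⟨m, a, rfl⟩ := exists_eq_add_cfVal hα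
  obtain ⟨hinf, hfin⟩ := (lagrangeConstant_eq_iff a m (by linarith)).mp hl
  obtain ⟨c, hc1, hc2⟩ := exists_between h1
  obtain ⟨U, hU, hK⟩ := exists_ultrafilter_of_infinite (hinf c (by linarith) hc2)
  obtain ⟨B, hB, -, hb⟩ := exists_belowBeta_limit h2 hfin hU
  have h4 := le_lam_of_limit hU hK hB
  have h5 := (hb.lam_zero_le hn).1
  linarith

/-! ### The endpoints belong to the spectrum -/

/-- The limsup of `lamNat a` is the largest value of `lam B 0` over all limit sequences `B`. -/
theorem mem_lagrangeSpectrum_of_limits {a : ℕ → ℕ+} (ha : ∀ k, a k ≤ 2) {l : ℝ} (hl : 2 < l)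
    (hle : ∀ (U : Ultrafilter ℕ) (B : ℤ → ℕ+), (U : Filter ℕ) ≤ atTop →
      (∀ j : ℤ, ∀ᶠ k : ℕ in U, a ((k : ℤ) + j).toNat = B j) → lam B 0 ≤ l)
    (hex : ∃ (U : Ultrafilter ℕ) (B : ℤ → ℕ+), (U : Filter ℕ) ≤ atTop ∧
      (∀ j : ℤ, ∀ᶠ k : ℕ in U, a ((k : ℤ) + j).toNat = B j) ∧ lam B 0 = l) :
    l ∈ lagrangeSpectrum := by
  refine ⟨(0 : ℤ) + cfVal a, ?_, (lagrangeConstant_eq_iff a 0 hl).mpr ⟨?_, ?_⟩⟩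
  · simpa using irrational_cfVal a
  · intro c _ hc
    obtain ⟨U, B, hU, hB, rfl⟩ := hex
    have h1 := (tendsto_lamNat hU hB).eventually (eventually_gt_nhds hc)
    intro hfin
    have h2 : ∀ᶠ k in atTop, ¬ c ≤ lamNat a k := by
      rw [← Nat.cofinite_eq_atTop, eventually_cofinite]
      simpa using hfin
    obtain ⟨k, hk1, hk2⟩ := (h1.and (h2.filter_mono hU)).exists
    exact hk2 hk1.le
  · intro c hc
    by_contra hinf
    obtain ⟨U, hU, hK⟩ := exists_ultrafilter_of_infinite hinf
    obtain ⟨B, hB⟩ := exists_limit_sequence U hU (Eventually.of_forall ha)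
    have h1 := le_lam_of_limit hU hK hB
    have h2 := hle U B hU hB
    linarith

theorem limit_le_two {a : ℕ → ℕ+} (ha : ∀ k, a k ≤ 2) {U : Ultrafilter ℕ} {B : ℤ → ℕ+}
    (hB : ∀ j : ℤ, ∀ᶠ k : ℕ in U, a ((k : ℤ) + j).toNat = B j) (j : ℤ) : B j ≤ 2 := by
  obtain ⟨k, hk⟩ := (hB j).exists
  rw [← hk]
  exact ha _

/-- A limit with a 2 at the origin must have its 2's exactly at the multiples of `2n + 1`, so both
sides are the `β_n` tail. -/
theorem lam_limit_betaTail {n : ℕ} {U : Ultrafilter ℕ} (hU : (U : Filter ℕ) ≤ atTop) {B : ℤ → ℕ+}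
    (hB : ∀ j : ℤ, ∀ᶠ k : ℕ in U, betaTail n ((k : ℤ) + j).toNat = B j) (h0 : B 0 = 2) :
    lam B 0 = gburBeta n := by
  have h2 : (2 : ℕ+) ≠ 1 := by decide
  have key : ∀ j : ℤ, B j = if ((2 * n + 1 : ℕ) : ℤ) ∣ j then 2 else 1 := by
    intro j
    obtain ⟨k, hk0, hkj, hk⟩ :=
      ((hB 0).and ((hB j).and ((eventually_ge_atTop (-j).toNat).filter_mono hU))).exists
    rw [h0, betaTail_get, add_zero, Int.toNat_natCast] at hk0
    have hk1 : k % (2 * n + 1) = 2 * n := by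
      by_contra hcon
      rw [if_neg hcon] at hk0
      exact h2 hk0.symm
    rw [← hkj, betaTail_get]
    have e : ((k : ℤ) + j).toNat % (2 * n + 1) = 2 * n ↔ ((2 * n + 1 : ℕ) : ℤ) ∣ j := by
      have hz : ((((k : ℤ) + j).toNat : ℕ) : ℤ) = k + j := Int.toNat_of_nonneg (by omega)
      have e1 : ((k : ℤ) + j).toNat % (2 * n + 1) = 2 * n ↔
          ((k : ℤ) + j).toNat ≡ k [MOD (2 * n + 1)] := by
        rw [Nat.ModEq, hk1]
      rw [e1, ← Int.natCast_modEq_iff, hz]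
      constructor
      · intro h
        have := h.symm.dvd
        simpa using this
      · intro h
        refine (Int.ModEq.symm ?_)
        rw [Int.modEq_iff_dvd]
        simpa using h
    simp only [e]
  have hr : ∀ k : ℕ, B (0 + 1 + k) = betaTail n k := by
    intro k
    rw [key, betaTail_get]
    have : ((2 * n + 1 : ℕ) : ℤ) ∣ 0 + 1 + k ↔ k % (2 * n + 1) = 2 * n := by
      rw [show (0 + 1 + k : ℤ) = ((k + 1 : ℕ) : ℤ) by push_cast; ring, Int.natCast_dvd_natCast,
        Nat.dvd_iff_mod_eq_zero, Nat.add_mod]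
      have := Nat.mod_lt k (show 0 < 2 * n + 1 by omega)
      rcases Nat.eq_zero_or_pos n with rfl | hn
      · simp [Nat.mod_one]
      rw [Nat.mod_eq_of_lt (show 1 < 2 * n + 1 by omega)]
      constructor
      · intro h
        by_contra hcon
        rw [Nat.mod_eq_of_lt (by omega)] at h
        omega
      · intro h
        rw [h, Nat.mod_self]
    simp only [this]
  have hl : ∀ k : ℕ, B (0 - 1 - k) = betaTail n k := by
    intro k
    rw [← hr, key, key, show (0 - 1 - k : ℤ) = -(0 + 1 + k) by ring]
    simp only [dvd_neg]
  rw [lam_eq, h0, leftVal, rightVal, gburBeta_eq, pnat_two_coe]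
  simp only [hl, hr]
  have e : (fun k => betaTail n k) = betaTail n := rfl
  rw [e]
  ring

theorem gburBeta_mem_lagrangeSpectrum {n : ℕ} (hn : 2 ≤ n) : gburBeta n ∈ lagrangeSpectrum := by
  have h1 := (lt_gburAlpha hn).trans (gburAlpha_lt_gburBeta hn)
  refine mem_lagrangeSpectrum_of_limits (betaTail_le_two n) (by linarith) ?_ ?_
  · intro U B hU hB
    rcases pnat_eq_one_or_two (limit_le_two (betaTail_le_two n) hB 0) with h0 | h0
    · have := lam_lt_of_not_isolated (limit_le_two (betaTail_le_two n) hB) 0 fun h => by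
        rw [h0] at h
        exact absurd h.1 (by decide)
      linarith
    · exact (lam_limit_betaTail hU hB h0).le
  · have hinf : {k | betaTail n k = 2}.Infinite := by
      refine Set.infinite_of_injective_forall_mem (f := fun m : ℕ => 2 * n + (2 * n + 1) * m) ?_ ?_
      · intro x y hxy
        have : (2 * n + 1) * x = (2 * n + 1) * y := Nat.add_left_cancel hxy
        exact Nat.eq_of_mul_eq_mul_left (by omega) this
      · intro m
        change betaTail n _ = 2
        rw [betaTail_get, if_pos]
        rw [Nat.add_mul_mod_self_left, Nat.mod_eq_of_lt (by omega)]
    obtain ⟨U, hU, hK⟩ := exists_ultrafilter_of_infinite hinf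
    obtain ⟨B, hB⟩ := exists_limit_sequence U hU (Eventually.of_forall (betaTail_le_two n))
    refine ⟨U, B, hU, hB, lam_limit_betaTail hU hB ?_⟩
    obtain ⟨k, hk1, hk2⟩ := ((hB 0).and (show ∀ᶠ k in U, betaTail n k = 2 from hK)).exists
    rw [← hk1, add_zero, Int.toNat_natCast, hk2]

/-! ### A one-sided sequence containing longer and longer pieces of Gbur's sequence -/

/-- The centres of the copies of Gbur's sequence. -/
def glueCenter (n m : ℕ) : ℕ := 2 * m ^ 2 + 6 * n * m

/-- The index of the copy that is used at the place `i`. -/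
def glueBlock (n i : ℕ) : ℕ := Nat.findGreatest (fun m => glueCenter n m ≤ i + (2 * n - 2)) i

/-- The one-sided sequence that follows Gbur's sequence around each centre. -/
def glueSeq (n : ℕ) (i : ℕ) : ℕ+ := gburSeq n ((i : ℤ) - glueCenter n (glueBlock n i))

/-- The spacing grows, so the copies get longer, and it is `6n + 2` modulo 4, which puts the right
periodic tail of one copy in phase with the left tail of the next. -/
theorem glueCenter_succ (n m : ℕ) :
    glueCenter n (m + 1) = glueCenter n m + (4 * m + 2 + 6 * n) := by
  unfold glueCenter; ring

theorem glueCenter_mono (n : ℕ) : Monotone (glueCenter n) :=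
  monotone_nat_of_le_succ fun m => by rw [glueCenter_succ]; omega

theorem le_glueCenter (n m : ℕ) : m ≤ glueCenter n m := by
  induction m with
  | zero => exact Nat.zero_le _
  | succ m ih => rw [glueCenter_succ]; omega

theorem mul_le_glueCenter (n m : ℕ) : 6 * n * m ≤ glueCenter n m := by
  unfold glueCenter; omega

theorem glueBlock_le (n i : ℕ) : glueCenter n (glueBlock n i) ≤ i + (2 * n - 2) :=
  Nat.findGreatest_spec (P := fun m => glueCenter n m ≤ i + (2 * n - 2)) (m := 0) (Nat.zero_le i)
    (by simp [glueCenter])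

theorem lt_glueBlock_succ {n : ℕ} (hn : 1 ≤ n) (i : ℕ) :
    i + (2 * n - 2) < glueCenter n (glueBlock n i + 1) := by
  by_cases h : glueBlock n i + 1 ≤ i
  · exact not_le.mp (Nat.findGreatest_is_greatest
      (P := fun m => glueCenter n m ≤ i + (2 * n - 2)) (Nat.lt_succ_self _) h)
  -- The search bound `i` in `Nat.findGreatest` is harmless: the centre number `i + 1` already lies
  -- beyond `i + (2n - 2)`.
  · have h1 : i + 1 ≤ glueBlock n i + 1 := by omega
    have h2 := glueCenter_mono n h1
    have h3 := mul_le_glueCenter n (i + 1)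
    have h4 : 6 * n * (i + 1) = 6 * (n * i) + 6 * n := by ring
    have h5 := Nat.le_mul_of_pos_left i hn
    omega

theorem glueBlock_eq {n : ℕ} (hn : 1 ≤ n) {i m : ℕ} (h1 : glueCenter n m ≤ i + (2 * n - 2))
    (h2 : i + (2 * n - 2) < glueCenter n (m + 1)) : glueBlock n i = m := by
  have h3 := glueBlock_le n i
  have h4 := lt_glueBlock_succ hn i
  apply le_antisymm
  · by_contra hcon
    have := glueCenter_mono n (show m + 1 ≤ glueBlock n i by omega)
    omega
  · by_contra hcon
    have := glueCenter_mono n (show glueBlock n i + 1 ≤ m by omega)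
    omega

theorem glueSeq_le_two {n : ℕ} (hn : 1 ≤ n) (i : ℕ) : glueSeq n i ≤ 2 := gburSeq_le_two hn _

theorem glueSeq_center {n : ℕ} (hn : 1 ≤ n) (m : ℕ) {i : ℕ} {j : ℤ}
    (hi : (i : ℤ) = glueCenter n m + j) (h1 : 2 - 2 * n ≤ j) (h2 : j < 4 * m + 4 + 4 * n) :
    glueSeq n i = gburSeq n j := by
  have := glueCenter_succ n m
  have hb : glueBlock n i = m := glueBlock_eq hn (by omega) (by omega)
  rw [glueSeq, hb]
  congr 1
  omega

/-- Around the centre number `m + 1` the sequence agrees with Gbur's one on a window whose length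
grows with `m`. -/
theorem glueSeq_window {n : ℕ} (hn : 1 ≤ n) (m : ℕ) {i : ℕ} {j : ℤ}
    (hi : (i : ℤ) = glueCenter n (m + 1) + j) (h1 : -(4 * m + 2 * n + 3) ≤ j)
    (h2 : j < 4 * (m + 1) + 4 + 4 * n) : glueSeq n i = gburSeq n j := by
  by_cases hj : 2 - 2 * n ≤ j
  · exact glueSeq_center hn (m + 1) hi hj (by push_cast; omega)
  · have hc := glueCenter_succ n m
    -- To the left of its block of ones the window lies in the right periodic tail of the preceding
    -- copy; the lower bound on `j` is exactly where that tail begins.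
    rw [glueSeq_center hn m (j := j + (4 * m + 2 + 6 * n)) (by omega) (by omega) (by omega)]
    refine pnat_eq_of_one_iff (gburSeq_le_two hn _) (gburSeq_le_two hn _) ?_
    rw [gburSeq_eq_one_iff hn, gburSeq_eq_one_iff hn]
    omega

theorem glueSeq_isolated {n : ℕ} (hn : 1 ≤ n) {i : ℕ} (hi : glueCenter n 1 ≤ i)
    (h0 : glueSeq n i = 2) (h1 : glueSeq n (i + 1) = 1) (h2 : glueSeq n (i - 1) = 1) :
    ∃ m, i = glueCenter n (m + 1) ∨ i = glueCenter n (m + 1) + 2 * n := by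
  have hb1 := glueBlock_le n i
  have hb2 := lt_glueBlock_succ hn i
  have hpos : glueBlock n i ≠ 0 := by
    intro h
    rw [h, zero_add] at hb2
    omega
  obtain ⟨m, hm⟩ := Nat.exists_eq_succ_of_ne_zero hpos
  rw [Nat.succ_eq_add_one] at hm
  rw [hm] at hb1 hb2
  have hc := glueCenter_succ n (m + 1)
  have hi1 : 1 ≤ i := by
    have := le_glueCenter n 1
    omega
  obtain ⟨j, hj⟩ : ∃ j : ℤ, (i : ℤ) = glueCenter n (m + 1) + j := ⟨i - glueCenter n (m + 1), by ring⟩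
  rw [glueSeq_window hn m hj (by omega) (by omega)] at h0
  rw [glueSeq_window hn m (j := j - 1) (by omega) (by omega) (by omega)] at h2
  refine ⟨m, ?_⟩
  by_cases hlt : j + 1 < 4 * (m + 1) + 4 + 4 * n
  · rw [glueSeq_window hn m (j := j + 1) (by push_cast; omega) (by omega) hlt] at h1
    rcases gburSeq_isolated hn h0 h1 h2 with h | h
    · left; omega
    · right; omega
  -- At the last place of a copy the preceding digit is a 2 of the periodic tail, contrary to `h2`.
  · rw [gburSeq_eq_one_iff hn] at h2
    omega

theorem limit_glueSeq {n : ℕ} (hn : 1 ≤ n) {F : Filter ℕ} [NeBot F] (hF : F ≤ atTop) {B : ℤ → ℕ+}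
    (hB : ∀ j : ℤ, ∀ᶠ k : ℕ in F, glueSeq n ((k : ℤ) + j).toNat = B j) {d : ℕ} (hd : d ≤ 2 * n)
    (h : ∀ᶠ k in F, ∃ m, k = glueCenter n (m + 1) + d) : B = fun j => gburSeq n (j + d) := by
  funext j
  obtain ⟨k, hk, ⟨m, rfl⟩, hk2⟩ := ((hB j).and (h.and
    ((eventually_ge_atTop (glueCenter n (j.natAbs + 1) + d)).filter_mono hF))).exists
  have hm : j.natAbs ≤ m := by
    by_contra hcon
    have h1 := glueCenter_mono n (show m + 1 ≤ j.natAbs by omega)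
    have h2 := glueCenter_succ n j.natAbs
    omega
  have := le_glueCenter n (m + 1)
  rw [← hk]
  refine glueSeq_window hn m ?_ (by omega) (by omega)
  have h1 : glueCenter n (m + 1) = glueCenter n m + (4 * m + 2 + 6 * n) := glueCenter_succ n m
  rw [Int.toNat_of_nonneg (by omega)]
  push_cast
  ring

theorem gburAlpha_mem_lagrangeSpectrum {n : ℕ} (hn : 2 ≤ n) : gburAlpha n ∈ lagrangeSpectrum := by
  have hn1 : 1 ≤ n := by omega
  have h1 := lt_gburAlpha hn
  refine mem_lagrangeSpectrum_of_limits (glueSeq_le_two hn1) (by linarith) ?_ ?_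
  · intro U B hU hB
    by_cases hiso : B 0 = 2 ∧ B (0 + 1) = 1 ∧ B (0 - 1) = 1
    · obtain ⟨b0, b1, b2⟩ := hiso
      have hev : ∀ᶠ k in U, (∃ m, k = glueCenter n (m + 1) + 0) ∨
          ∃ m, k = glueCenter n (m + 1) + 2 * n := by
        filter_upwards [hB 0, hB (0 + 1), hB (0 - 1),
          (eventually_ge_atTop (glueCenter n 1 + 1)).filter_mono hU] with k k0 k1 k2 k3
        rw [b0, show ((k : ℤ) + 0).toNat = k by omega] at k0
        rw [b1, show ((k : ℤ) + (0 + 1)).toNat = k + 1 by omega] at k1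
        rw [b2, show ((k : ℤ) + (0 - 1)).toNat = k - 1 by omega] at k2
        obtain ⟨m, hm | hm⟩ := glueSeq_isolated hn1 (by omega) k0 k1 k2
        · exact Or.inl ⟨m, hm⟩
        · exact Or.inr ⟨m, hm⟩
      rcases Ultrafilter.eventually_or.mp hev with h | h
      · rw [limit_glueSeq hn1 hU hB (by omega) h, lam_shift]
        exact (lam_gburSeq_zero n).le
      · rw [limit_glueSeq hn1 hU hB le_rfl h, lam_shift]
        push_cast
        exact (lam_gburSeq_two_mul hn1).le
    · have := lam_lt_of_not_isolated (limit_le_two (glueSeq_le_two hn1) hB) 0 hiso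
      linarith
  · have hinf : {k | ∃ m, k = glueCenter n (m + 1) + 0}.Infinite := by
      refine Set.infinite_of_injective_forall_mem (f := fun m : ℕ => glueCenter n (m + 1) + 0) ?_
        fun m => ⟨m, rfl⟩
      refine StrictMono.injective (strictMono_nat_of_lt_succ fun m => ?_)
      have := glueCenter_succ n (m + 1)
      omega
    obtain ⟨U, hU, hK⟩ := exists_ultrafilter_of_infinite hinf
    obtain ⟨B, hB⟩ := exists_limit_sequence U hU (Eventually.of_forall (glueSeq_le_two hn1))
    refine ⟨U, B, hU, hB, ?_⟩
    rw [limit_glueSeq hn1 hU hB (by omega) hK, lam_shift]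
    exact lam_gburSeq_zero n

/-! ### `α_n^*` is not admissible -/

/-- Reading leftwards from a place whose continuation contains two adjacent ones later on, the
finite continued fraction exceeds the periodic one. -/
theorem cfVal_perTail_lt_cfRev {a : ℕ → ℕ+} {J : ℕ} (h2 : ∀ k, J ≤ k → a k ≤ 2)
    (hno : ∀ k, J ≤ k → ¬ (a k = 1 ∧ a (k + 1) = 2 ∧ a (k + 2) = 1 ∧ a (k + 3) = 2))
    {k₀ p : ℕ} (hk : J + 2 ≤ k₀) (hp : k₀ ≤ p) (h1 : a (k₀ - 1) = 1) (h1' : a (k₀ - 2) = 1) :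
    cfVal perTail < cfRev a p := by
  classical
  -- Agreement up to the two adjacent ones is impossible, since the ones of the periodic tail are
  -- isolated. The difference occurs while the indices are still at least `J`.
  have hex : ∃ m, m ≤ p - k₀ + 1 ∧ a (p - 1 - m) ≠ perTail m := by
    by_contra hcon
    push Not at hcon
    have e1 := hcon (p - k₀) (by omega)
    have e2 := hcon (p - k₀ + 1) le_rfl
    rw [show p - 1 - (p - k₀) = k₀ - 1 by omega, h1, perTail] at e1
    rw [show p - 1 - (p - k₀ + 1) = k₀ - 2 by omega, h1', perTail] at e2
    have d : (1 : ℕ+) ≠ 2 := by decide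
    have f1 : (p - k₀) % 4 = 1 := by
      by_contra h
      rw [if_neg h] at e1
      exact d e1
    have f2 : (p - k₀ + 1) % 4 = 1 := by
      by_contra h
      rw [if_neg h] at e2
      exact d e2
    omega
  obtain ⟨hm, hne⟩ := Nat.find_spec hex
  have hmin : ∀ i < Nat.find hex, a (p - 1 - i) = perTail i := by
    intro i hi
    by_contra hcon
    exact Nat.find_min hex hi ⟨by omega, hcon⟩
  generalize Nat.find hex = m at *
  rw [cfRev_eq_cfTail a (m + 1) p (by omega)]
  refine cfVal_perTail_lt (w := fun i => a (p - 1 - i)) (cfRev_nonneg _ _) (cfRev_le_one _ _) hmin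
    hne (h2 _ (by omega)) ?_
  rintro i rfl ⟨k0, k1, k2, k3⟩
  refine hno (p - 1 - (i + 3)) (by omega) ⟨k3, ?_, ?_, ?_⟩
  · rw [← k2]; congr 1; omega
  · rw [← k1]; congr 1; omega
  · rw [← k0]; congr 1; omega

theorem cfTail_le_of_odd {k : ℕ} (hk : Odd k) (a : ℕ → ℕ+) {x y : ℝ} (hx : 0 ≤ x) (hxy : x ≤ y) :
    cfTail k a y ≤ cfTail k a x := by
  rcases hxy.eq_or_lt with rfl | h
  · exact le_rfl
  · exact ((cfTail_lt k a hx h).2 hk).le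

/-- A piece `u, 2, v` inside a one-sided sequence, where `u` and `v` are initial pieces of
sequences that end in the periodic tail. -/
theorem lamNat_lt_of_window {a : ℕ → ℕ+} {J : ℕ} (h2 : ∀ k, J ≤ k → a k ≤ 2)
    (hno : ∀ k, J ≤ k → ¬ (a k = 1 ∧ a (k + 1) = 2 ∧ a (k + 2) = 1 ∧ a (k + 3) = 2))
    (hno' : ∀ k, J ≤ k → ¬ (a k = 2 ∧ a (k + 1) = 1 ∧ a (k + 2) = 2 ∧ a (k + 3) = 1))
    {u v : ℕ → ℕ+} {p q : ℕ} (hp : Odd p) (hq : Odd q) (hu : ∀ i, u (i + p) = perTail i)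
    (hv : ∀ i, v (i + q) = perTail i) {k₀ k : ℕ} (hk : J + 2 ≤ k₀) (hkp : k₀ + p ≤ k)
    (h1 : a (k₀ - 1) = 1) (h1' : a (k₀ - 2) = 1) (h0 : a k = 2)
    (hl : ∀ i < p, a (k - 1 - i) = u i) (hr : ∀ i < q, a (k + 1 + i) = v i) :
    lamNat a k < 2 + cfVal u + cfVal v := by
  have hlt := cfVal_perTail_lt_cfRev h2 hno hk (p := k - p) (by omega) h1 h1'
  have hL : cfRev a k < cfVal u := by
    rw [cfRev_eq_cfTail a p k (by omega), cfVal_eq_cfTail p u, cfTail_congr hl]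
    simp only [hu]
    exact (cfTail_lt p u (cfVal_nonneg _) hlt).2 hp
  have hR : (cfVal fun i => a (k + 1 + i)) ≤ cfVal v := by
    rw [cfVal_eq_cfTail q fun i => a (k + 1 + i), cfVal_eq_cfTail q v, cfTail_congr hr]
    simp only [hv]
    refine cfTail_le_of_odd hq v (cfVal_nonneg _) ?_
    refine cfVal_perTail_le (fun i => h2 _ (by omega)) fun i hi => ?_
    obtain ⟨k0, k1, k2, k3⟩ := hi
    refine hno' (k + 1 + (i + q)) (by omega) ⟨k0, ?_, ?_, ?_⟩
    · rw [← k1]; congr 1; omega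
    · rw [← k2]; congr 1; omega
    · rw [← k3]; congr 1; omega
  unfold lamNat
  rw [h0, pnat_two_coe]
  linarith

theorem gburX_tail (n i : ℕ) (hn : 1 ≤ n) : gburX n (i + (2 * n - 1)) = perTail i := by
  rw [gburX_get, if_neg (by omega), perTail]
  congr 1
  simp only [eq_iff_iff]
  omega

theorem gburY_tail (n i : ℕ) (hn : 1 ≤ n) : gburY n (i + (4 * n - 1)) = perTail i := by
  rw [gburY_get hn, if_neg (by omega), if_neg (by omega), ← gburX_tail n i hn]
  congr 1
  omega

theorem not_isAdmissible_gburAlpha {n : ℕ} (hn : 2 ≤ n) : ¬ IsAdmissible (gburAlpha n) := by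
  rintro ⟨-, α, hatt, hL⟩
  have hn1 : 1 ≤ n := by omega
  have h3 := lt_gburAlpha hn
  obtain ⟨m, a, rfl⟩ := exists_eq_add_cfVal hatt.1
  obtain ⟨-, hfin⟩ := (lagrangeConstant_eq_iff a m (by linarith)).mp hL
  have hK := infinite_of_isAttainable a m (by linarith) hatt hL
  have hlim : ∀ U : Ultrafilter ℕ, (U : Filter ℕ) ≤ atTop →
      ∃ B : ℤ → ℕ+, (∀ j : ℤ, ∀ᶠ k : ℕ in U, a ((k : ℤ) + j).toNat = B j) ∧
        (∀ i, lam B i ≤ gburAlpha n) ∧ BelowBeta n B :=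
    fun U hU => exists_belowBeta_limit (gburAlpha_lt_gburBeta hn) hfin hU
  have hnat : ∀ (k j : ℕ), ((k : ℤ) + (j : ℕ)).toNat = k + j := fun k j => by omega
  -- A pattern of four digits that no limit sequence shows can occur only finitely often, as
  -- otherwise a limit along its occurrences would show it.
  have hevery : ∀ P : ℕ+ → ℕ+ → ℕ+ → ℕ+ → Prop,
      (∀ B : ℤ → ℕ+, BelowBeta n B → ¬ P (B 0) (B (0 + 1)) (B (0 + 2)) (B (0 + 3))) →
      ∀ᶠ k in atTop, ¬ P (a k) (a (k + 1)) (a (k + 2)) (a (k + 3)) := by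
    intro P hP
    rw [← Nat.cofinite_eq_atTop, eventually_cofinite]
    by_contra hinf
    obtain ⟨U, hU, hU2⟩ := exists_ultrafilter_of_infinite hinf
    obtain ⟨B, hB, -, hb⟩ := hlim U hU
    refine hP B hb ?_
    obtain ⟨k, k0, k1, k2, k3, hk⟩ := ((hB (0 : ℕ)).and ((hB (1 : ℕ)).and ((hB (2 : ℕ)).and
      ((hB (3 : ℕ)).and (Filter.Eventually.mono hU2 fun _ hk => not_not.mp hk))))).exists
    rw [hnat] at k0 k1 k2 k3
    push_cast at k0 k1 k2 k3
    simp only [zero_add]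
    rw [← k0, ← k1, ← k2, ← k3]
    exact hk
  have e1 := hevery (fun b _ _ _ => ¬ b ≤ 2) fun B hb h => h (hb.le_two 0)
  have e2 := hevery (fun b c d e => b = 2 ∧ c = 1 ∧ d = 2 ∧ e = 1) fun B hb => hb.not_2121 0
  have e3 := hevery (fun b c d e => b = 1 ∧ c = 2 ∧ d = 1 ∧ e = 2) fun B hb h => by
    refine hb.neg.not_2121 (-3) ?_
    obtain ⟨k0, k1, k2, k3⟩ := h
    exact ⟨by simpa using k3, by simpa using k2, by simpa using k1, by simpa using k0⟩
  obtain ⟨J, hJ⟩ := eventually_atTop.mp (e1.and (e2.and e3))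
  obtain ⟨U, hU, hKU⟩ := exists_ultrafilter_of_infinite hK
  obtain ⟨B, hB, hle, hb⟩ := hlim U hU
  have h0 := (hb.lam_zero_le hn).2 (le_antisymm (hle 0) (le_lam_of_limit hU hKU hB))
  have hB0 : B 0 = 2 ∧ B (-1) = 1 ∧ B (-2) = 1 := by
    rcases h0 with rfl | rfl
    · exact ⟨rfl, (gburSeq_eq_one_iff hn1 _).mpr (by omega),
        (gburSeq_eq_one_iff hn1 _).mpr (by omega)⟩
    · exact ⟨rfl, (gburSeq_eq_one_iff hn1 _).mpr (by omega),
        (gburSeq_eq_one_iff hn1 _).mpr (by omega)⟩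
  -- Radius `4n` covers the nonperiodic prefixes, of lengths `2n-1` on the X side and `4n-1` on the
  -- Y side.
  have hwin : ∀ᶠ k : ℕ in U, gburAlpha n ≤ lamNat a k ∧
      ∀ j ∈ Finset.Icc (-(4 * n : ℤ)) (4 * n), a ((k : ℤ) + j).toNat = B j :=
    (show ∀ᶠ k in U, gburAlpha n ≤ lamNat a k from hKU).and
      ((Finset.eventually_all _).mpr fun j _ => hB j)
  have hlarge : ∀ N : ℕ, ∀ᶠ k : ℕ in U, N ≤ k := fun N => (eventually_ge_atTop N).filter_mono hU
  -- The earlier place `k₀` only supplies two adjacent ones; the contradiction is at the later place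
  -- `k`.
  obtain ⟨k₀, ⟨-, hw0⟩, hk0⟩ := (hwin.and (hlarge (J + 2))).exists
  obtain ⟨k, ⟨hlam, hw⟩, hk⟩ := (hwin.and (hlarge (k₀ + 4 * n))).exists
  have a1 : a (k₀ - 1) = 1 := by
    rw [← hB0.2.1, ← hw0 (-1) (by simp; omega)]
    congr 1
    omega
  have a2 : a (k₀ - 2) = 1 := by
    rw [← hB0.2.2, ← hw0 (-2) (by simp; omega)]
    congr 1
    omega
  have a0 : a k = 2 := by
    rw [← hB0.1, ← hw 0 (by simp)]
    simp
  have hl : ∀ i : ℕ, i < 4 * n → a (k - 1 - i) = B (0 - 1 - i) := fun i hi => by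
    rw [← hw _ (by simp; omega)]
    congr 1
    omega
  have hr : ∀ i : ℕ, i < 4 * n → a (k + 1 + i) = B (0 + 1 + i) := fun i hi => by
    rw [← hw _ (by simp; omega)]
    congr 1
    omega
  have j2 : ∀ k, J ≤ k → a k ≤ 2 := fun k hk => not_not.mp (hJ k hk).1
  have oX := odd_two_mul_sub hn1
  have oY : Odd (4 * n - 1) := ⟨2 * n - 1, by omega⟩
  refine absurd hlam (not_le.mpr ?_)
  rcases h0 with rfl | rfl
  · exact lamNat_lt_of_window j2 (fun k hk => (hJ k hk).2.2) (fun k hk => (hJ k hk).2.1) oX oY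
      (fun i => gburX_tail n i hn1) (fun i => gburY_tail n i hn1) hk0 (by omega) a1 a2 a0
      (fun i hi => by rw [hl i (by omega), gburSeq_left])
      (fun i hi => by rw [hr i (by omega), gburSeq_right])
  · have := lamNat_lt_of_window j2 (fun k hk => (hJ k hk).2.2) (fun k hk => (hJ k hk).2.1) oY oX
      (fun i => gburY_tail n i hn1) (fun i => gburX_tail n i hn1) hk0 (by omega) a1 a2 a0
      (fun i hi => by
        rw [hl i (by omega), ← gburSeq_right]
        exact congrArg _ (by ring))
      (fun i hi => by
        rw [hr i (by omega), ← gburSeq_left]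
        exact congrArg _ (by ring))
    rw [gburAlpha]
    linarith

/-! ### Irrationality of `α_n^*` -/

/-- `x = u + v √30` with rational `u` and `v`, where `v` has the sign of `σ` and the conjugate
`u - v √30` is positive. -/
def QuadSign (σ : ℚ) (x : ℝ) : Prop :=
  ∃ u v : ℚ, x = u + v * √30 ∧ 0 < σ * v ∧ (0 : ℝ) < u - v * √30

/-- The norm of `b + x` is positive because `x` and its conjugate are, so inversion keeps the
conjugate positive and flips the sign of the `√30`-coefficient. -/
theorem QuadSign.one_div_add {σ : ℚ} {x : ℝ} (h : QuadSign σ x) (hx : 0 < x) (b : ℕ) :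
    QuadSign (-σ) (1 / (b + x)) := by
  obtain ⟨u, v, rfl, hv, hc⟩ := h
  have hs : √30 * √30 = (30 : ℝ) := Real.mul_self_sqrt (by norm_num)
  have hb : (0 : ℝ) ≤ b := Nat.cast_nonneg b
  have hN : (0 : ℝ) < (b + u) ^ 2 - 30 * v ^ 2 := by
    have e : ((b : ℝ) + u) ^ 2 - 30 * v ^ 2 = (b + (u + v * √30)) * (b + (u - v * √30)) := by
      linear_combination (v : ℝ) ^ 2 * hs
    rw [e]
    positivity
  have hN' : 0 < ((b : ℚ) + u) ^ 2 - 30 * v ^ 2 := by exact_mod_cast hN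
  refine ⟨(b + u) / ((b + u) ^ 2 - 30 * v ^ 2), -v / ((b + u) ^ 2 - 30 * v ^ 2), ?_, ?_, ?_⟩
  · push_cast
    rw [div_eq_iff (by positivity)]
    field_simp
    linear_combination (v : ℝ) ^ 2 * hs
  · rw [show -σ * (-v / (((b : ℚ) + u) ^ 2 - 30 * v ^ 2)) =
      σ * v / (((b : ℚ) + u) ^ 2 - 30 * v ^ 2) by ring]
    positivity
  · push_cast
    rw [show ((b : ℝ) + u) / ((b + u) ^ 2 - 30 * v ^ 2) -
      -v / ((b + u) ^ 2 - 30 * v ^ 2) * √30 =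
      (b + (u + v * √30)) / ((b + u) ^ 2 - 30 * v ^ 2) by ring]
    positivity

theorem QuadSign.psi_add {σ : ℚ} {t : ℝ} {l : ℕ} (h : QuadSign σ (psi l t)) (ht : 0 < t) (j : ℕ) :
    QuadSign ((-1) ^ j * σ) (psi (l + j) t) := by
  induction j with
  | zero => simpa using h
  | succ j ih =>
    have := ih.one_div_add (psi_pos _ ht) 1
    rw [pow_succ, mul_neg_one, neg_mul]
    simpa [psi, ← add_assoc] using this

theorem cfVal_perTail : cfVal perTail = -1 + √30 / 4 := by
  have h4 := cfVal_eq_cfTail 4 perTail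
  have e : (fun i => perTail (i + 4)) = perTail := by
    funext i
    simp [perTail]
  have p0 : perTail 0 = 2 := rfl
  have p1 : perTail 1 = 1 := rfl
  have p2 : perTail 2 = 2 := rfl
  have p3 : perTail 3 = 2 := rfl
  have hW := cfVal_pos perTail
  rw [e] at h4
  simp only [cfTail, zero_add, p0, p1, p2, p3, Nat.reduceAdd, pnat_two_coe, PNat.one_coe,
    Nat.cast_one] at h4
  generalize cfVal perTail = x at *
  have hs : √30 * √30 = (30 : ℝ) := Real.mul_self_sqrt (by norm_num)
  have hs0 : (0 : ℝ) ≤ √30 := Real.sqrt_nonneg _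
  have hq : 8 * x ^ 2 + 16 * x - 7 = 0 := by
    field_simp at h4
    linarith
  have hz : (x + 1 - √30 / 4) * (x + 1 + √30 / 4) = 0 := by nlinarith
  rcases mul_eq_zero.mp hz with h | h <;> linarith

theorem quadSign_gburX {n : ℕ} (hn : 2 ≤ n) : QuadSign (-1) (cfVal (gburX n)) := by
  have hs : √30 * √30 = (30 : ℝ) := Real.mul_self_sqrt (by norm_num)
  have hs0 : (0 : ℝ) ≤ √30 := Real.sqrt_nonneg _
  have hW := cfVal_pos perTail
  -- The periodic tail has a negative conjugate; two ones must be prefixed before the conjugate of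
  -- the value becomes positive. The value is `3/2 - √30/6`.
  have h2 : QuadSign (-1) (psi 2 (2 + cfVal perTail)) := by
    refine ⟨3 / 2, -1 / 6, ?_, by norm_num, ?_⟩
    · rw [cfVal_perTail]
      simp only [psi]
      push_cast
      have h1 : ∀ t : ℝ, 0 < t → 1 / (1 + 1 / (1 + 1 / t)) = (t + 1) / (2 * t + 1) := by
        intro t ht
        have : 0 < t + 1 := by linarith
        field_simp
        ring
      rw [h1 _ (by linarith), div_eq_iff (by linarith)]
      linear_combination (1 / 12 : ℝ) * hs
    · push_cast
      linarith
  have h := h2.psi_add (by linarith) (2 * n - 4)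
  rw [cfVal_gburX, show 2 * n - 2 = 2 + (2 * n - 4) by omega]
  rwa [Even.neg_one_pow ⟨n - 2, by omega⟩, one_mul] at h

theorem quadSign_gburY {n : ℕ} (hn : 2 ≤ n) : QuadSign (-1) (cfVal (gburY n)) := by
  have hX := cfVal_pos (gburX n)
  have h0 := (quadSign_gburX hn).one_div_add hX 2
  have h := QuadSign.psi_add (t := 2 + cfVal (gburX n)) (l := 0) (by simpa [psi] using h0)
    (by linarith) (2 * n - 1)
  rw [cfVal_gburY (by omega)]
  rwa [(odd_two_mul_sub (by omega)).neg_one_pow, zero_add, mul_one] at h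

theorem irrational_gburAlpha {n : ℕ} (hn : 2 ≤ n) : Irrational (gburAlpha n) := by
  obtain ⟨u, v, hX, hv, -⟩ := quadSign_gburX hn
  obtain ⟨u', v', hY, hv', -⟩ := quadSign_gburY hn
  have hirr : Irrational (√30 : ℝ) := by
    have := irrational_sqrt_natCast_iff (n := 30)
    push_cast at this
    rw [this]
    rintro ⟨r, hr⟩
    have : r < 6 := by nlinarith
    interval_cases r <;> omega
  have e : gburAlpha n = ((v + v' : ℚ) : ℝ) * √30 + ((2 + u + u' : ℚ) : ℝ) := by
    rw [gburAlpha, hX, hY]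
    push_cast
    ring
  rw [e]
  exact (hirr.ratCast_mul (by linarith)).add_ratCast _

theorem theorem3 (n : ℕ) (hn : 2 ≤ n) :
    Irrational (gburAlpha n) ∧
    ¬ IsAdmissible (gburAlpha n) ∧
    gburAlpha n ∈ lagrangeSpectrum ∧
    IsMaximalGap lagrangeSpectrum (gburAlpha n) (gburBeta n) ∧
    (∀ B : ℤ → ℕ+, Realizes B (gburAlpha n) ↔
      B = gburSeq n ∨ B = fun i => gburSeq n (-i)) ∧
    (∀ B : ℤ → ℕ+, Realizes B (gburAlpha n) → ¬ IsPurelyPeriodic B) := by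
  refine ⟨irrational_gburAlpha hn, not_isAdmissible_gburAlpha hn,
    gburAlpha_mem_lagrangeSpectrum hn,
    ⟨gburAlpha_lt_gburBeta hn, gburAlpha_mem_lagrangeSpectrum hn,
      gburBeta_mem_lagrangeSpectrum hn, disjoint_gap_lagrangeSpectrum hn⟩,
    realizes_gburAlpha_iff hn, fun B hB hper => ?_⟩
  rcases (realizes_gburAlpha_iff hn B).mp hB with rfl | rfl
  · exact not_isPurelyPeriodic_gburSeq hn hper
  · refine not_isPurelyPeriodic_gburSeq hn ?_
    simpa using hper.neg
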